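/- Let $r\ge 0$ and $n\ge 1$ be integers and let $F_r$ be the free group on $x_1,\dots,x_r$. For a complex linear algebraic group $G\subseteq GL_n$ let $\mathfrak X_r(G)=\operatorname{Spec}\big(\mathbb C[\operatorname{Hom}(F_r,G)]^{G}\big)$ be its character variety, where $\operatorname{Hom}(F_r,G)\cong G^r$ and $G$ acts by conjugation. For $K=U(n)$ or $SU(n)$ let $\mathfrak X_r(K)=\operatorname{Hom}(F_r,K)/K$ be the space of conjugation orbits, with the quotient topology and with the semi-algebraic structure of a quotient of the compact semi-algebraic set $K^r$ (a subset is semi-algebraic if its preimage is; a map is semi-algebraic if its graph is). Let $\mathbb Z_n$ be the group of $n$-th roots of unity. As scalar matrices it is the center of $SL_n$ and also the center of $SU(n)$. Let $\zeta\in\mathbb Z_n^r$ act on $\mathfrak X_r(SL_n)\times(\mathbb C^*)^r$ and on $\mathfrak X_r(SU(n))\times(S^1)^r$ by $\zeta\cdot([\rho],t)=([\zeta\rho],\zeta^{-1}t)$, where $(\zeta\rho)(x_k)=\zeta_k\rho(x_k)$. Put $$\mathfrak X_r(SL_n)\times_{\mathbb Z_n^r}(\mathbb C^*)^r=\big(\mathfrak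 X_r(SL_n)\times(\mathbb C^*)^r\big)/\!\!/\mathbb Z_n^r,\qquad \mathfrak X_r(SU(n))\times_{\mathbb Z_n^r}(S^1)^r=\big(\mathfrak X_r(SU(n))\times(S^1)^r\big)/\mathbb Z_n^r ,$$ the first being the spectrum of the ring of invariant regular functions, the second the orbit space. Then: 1. There is an isomorphism of affine algebraic varieties over $\mathbb C$ $$\mathfrak X_r(SL_n)\times_{\mathbb Z_n^r}(\mathbb C^*)^r\;\cong\;\mathfrak X_r(GL_n),\qquad [[\rho],t]\mapsto[t\rho],\quad (t\rho)(x_k)=t_k\rho(x_k).$$ It exhibits $\mathfrak X_r(GL_n)$ as a twisted $\mathfrak X_r(SL_n)$-bundle over $(\mathbb C^*)^r$: with $\det[\rho]=(\det\rho(x_k))_k$, the square $$\begin{array}{ccc}\mathfrak X_r(SL_n)\times(\mathbb C^*)^r&\longrightarrow&\mathfrak X_r(GL_n)\\ \downarrow&&\downarrow{\scriptstyle\det}\\ (\mathbb C^*)^r&\xrightarrow{\;t\mapsto t^n\;}&(\mathbb C^*)^r\end{array}$$ whose top arrow is the quotient map followed by the isomorphism and whose left arrow is the projection, is Cartesian;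 that is, $\det$ becomes the trivial bundle after pull-back along the $n$-th power map of the torus. 2. There is an isomorphism of semi-algebraic sets (a homeomorphism with semi-algebraic graph) $$\mathfrak X_r(SU(n))\times_{\mathbb Z_n^r}(S^1)^r\;\cong\;\mathfrak X_r(U(n)),\qquad [[\rho],t]\mapsto[t\rho].$$ It carries $[[\rho],t]\mapsto t^n$ to the determinant map $\det:\mathfrak X_r(U(n))\to(S^1)^r$, and $\det$ is a locally trivial fiber bundle with fiber $\mathfrak X_r(SU(n))$. -/

import Mathlib

open CategoryTheory AlgebraicGeometry TensorProduct

noncomputable section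

namespace CharVar

/-! ### Representations of a free group -/

/-- `Hom(F_r, G)`, where `F_r` is the free group on `r` generators. -/
def RepVar (r : ℕ) (G : Type) [Group G] : Type := FreeGroup (Fin r) →* G

namespace RepVar

variable {r : ℕ} {G : Type} [Group G]

/-- The value of a representation on the `k`-th generator. -/
def gen (ρ : RepVar r G) (k : Fin r) : G :=
  (show FreeGroup (Fin r) →* G from ρ) (FreeGroup.of k)

/-- The representation with prescribed values on the generators. -/
def ofTuple (a : Fin r → G) : RepVar r G := FreeGroup.lift a

@[simp] theorem gen_ofTuple (a : Fin r → G) (k : Fin r) : (ofTuple a).gen k = a k := by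
  change FreeGroup.lift a (FreeGroup.of k) = a k
  simp

theorem ext_gen {ρ σ : RepVar r G} (h : ∀ k, ρ.gen k = σ.gen k) : ρ = σ :=
  FreeGroup.ext_hom ρ σ h

/-- `G` acts on `Hom(F_r, G)` by conjugation. -/
instance : MulAction G (RepVar r G) where
  smul g ρ := MonoidHom.comp (MulAut.conj g).toMonoidHom ρ
  one_smul ρ := ext_gen fun k => by
    change (1 : G) * ρ.gen k * 1⁻¹ = ρ.gen k
    simp
  mul_smul g h ρ := ext_gen fun k => by
    change (g * h) * ρ.gen k * (g * h)⁻¹ = g * (h * ρ.gen k * h⁻¹) * g⁻¹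
    group

@[simp] theorem gen_smul (g : G) (ρ : RepVar r G) (k : Fin r) :
    (g • ρ).gen k = g * ρ.gen k * g⁻¹ := rfl

/-- The topology of `G ^ r`, carried over by evaluation on the generators. -/
instance [TopologicalSpace G] : TopologicalSpace (RepVar r G) :=
  TopologicalSpace.induced gen inferInstance

end RepVar

/-! ### The groups and their scalar matrices -/

abbrev GLn (n : ℕ) : Type := Matrix.GeneralLinearGroup (Fin n) ℂ

abbrev SLn (n : ℕ) : Type := Matrix.SpecialLinearGroup (Fin n) ℂ

abbrev Un (n : ℕ) : Type := Matrix.unitaryGroup (Fin n) ℂ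

abbrev SUn (n : ℕ) : Type := Matrix.specialUnitaryGroup (Fin n) ℂ

/-- The `n`-th roots of unity; they embed as scalar matrices in `SL_n` and in `SU(n)`. -/
abbrev Zn (n : ℕ) : Type := rootsOfUnity n ℂ

def scalarSL (n : ℕ) : Zn n →* SLn n where
  toFun ω := ⟨Matrix.scalar (Fin n) ((ω : ℂˣ) : ℂ), by
    have h : ((ω : ℂˣ) : ℂ) ^ n = 1 := (mem_rootsOfUnity' n _).1 ω.2
    simp [h]⟩
  map_one' := by ext; simp
  map_mul' a b := by
    apply Subtype.ext
    change Matrix.scalar (Fin n) _ = Matrix.scalar (Fin n) _ * Matrix.scalar (Fin n) _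
    simp

def scalarU (n : ℕ) : Circle →* Un n where
  toFun c := ⟨Matrix.scalar (Fin n) (c : ℂ), by
    rw [Matrix.mem_unitaryGroup_iff]
    ext i j
    simp [Matrix.star_eq_conjTranspose, Matrix.one_apply, Matrix.diagonal_apply, Complex.mul_conj]⟩
  map_one' := by
    apply Subtype.ext
    simp
  map_mul' a b := by
    apply Subtype.ext
    simp

def scalarSU (n : ℕ) [NeZero n] : Zn n →* SUn n where
  toFun ω := ⟨Matrix.scalar (Fin n) ((ω : ℂˣ) : ℂ), by
    have h : ((ω : ℂˣ) : ℂ) ^ n = 1 := (mem_rootsOfUnity' n _).1 ω.2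
    exact ⟨(scalarU n (rootsOfUnitytoCircle n ω)).2, by simp [MonoidHom.mem_mker, h]⟩⟩
  map_one' := by
    apply Subtype.ext
    simp
  map_mul' a b := by
    apply Subtype.ext
    simp

/-- The inclusion `SU(n) → U(n)`. -/
def inclSU (n : ℕ) : SUn n →* Un n where
  toFun A := ⟨A.1, A.2.1⟩
  map_one' := rfl
  map_mul' _ _ := rfl

/-- The determinant `U(n) → S¹`. -/
def detU (n : ℕ) : Un n →* Circle where
  toFun A := ⟨A.1.det, by
    rw [Submonoid.unitSphere, Submonoid.mem_mk, Subsemigroup.mem_mk, mem_sphere_zero_iff_norm]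
    exact (CStarRing.norm_of_mem_unitary (Matrix.det_of_mem_unitary A.2))⟩
  map_one' := by
    apply Subtype.ext
    simp
  map_mul' a b := by
    apply Subtype.ext
    change (a.1 * b.1).det = a.1.det * b.1.det
    simp

/-! ### Affine varieties over `ℂ`: schemes over `Spec ℂ` -/

/-- The affine `ℂ`-scheme with coordinate ring `A`. -/
def affine (A : Type) [CommRing A] [Algebra ℂ A] : Over (Spec (CommRingCat.of ℂ)) :=
  Over.mk (Spec.map (CommRingCat.ofHom (algebraMap ℂ A)))

/-- The morphism of affine `ℂ`-schemes given by a homomorphism of coordinate rings. -/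
def affineMap {A B : Type} [CommRing A] [Algebra ℂ A] [CommRing B] [Algebra ℂ B]
    (φ : A →ₐ[ℂ] B) : affine B ⟶ affine A :=
  Over.homMk (Spec.map (CommRingCat.ofHom φ.toRingHom)) (by
    change Spec.map _ ≫ Spec.map _ = Spec.map _
    rw [← Spec.map_comp, ← CommRingCat.ofHom_comp]
    congr 2
    exact φ.comp_algebraMap)

/-- Pull-back of `ℂ`-valued functions. -/
def pull {X Y : Type} (φ : X → Y) : (Y → ℂ) →ₐ[ℂ] (X → ℂ) where
  toFun f := f ∘ φ
  map_one' := rfl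
  map_mul' _ _ := rfl
  map_zero' := rfl
  map_add' _ _ := rfl
  commutes' _ := rfl

/-- The ring of regular functions belonging to an algebra `R` of functions on `X`. -/
def Reg {X : Type} (R : Subalgebra ℂ (X → ℂ)) : Type := R

instance {X : Type} (R : Subalgebra ℂ (X → ℂ)) : CommRing (Reg R) := inferInstanceAs (CommRing R)

instance {X : Type} (R : Subalgebra ℂ (X → ℂ)) : Algebra ℂ (Reg R) := inferInstanceAs (Algebra ℂ R)

/-- A regular function as a function. -/
def Reg.toFun {X : Type} (R : Subalgebra ℂ (X → ℂ)) : Reg R →ₐ[ℂ] (X → ℂ) := R.val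

/-- Pull-back of regular functions along a map that preserves regularity. -/
def pullReg {X Y : Type} {R : Subalgebra ℂ (X → ℂ)} {S : Subalgebra ℂ (Y → ℂ)} (φ : X → Y)
    (h : ∀ f ∈ S, f ∘ φ ∈ R) : Reg S →ₐ[ℂ] Reg R :=
  ((pull φ).comp S.val).codRestrict R fun f => h f.1 f.2

/-- Evaluation of regular functions at a point. -/
def evalReg {X : Type} (R : Subalgebra ℂ (X → ℂ)) (x : X) : Reg R →ₐ[ℂ] ℂ :=
  (Pi.evalAlgHom ℂ (fun _ : X => ℂ) x).comp (Reg.toFun R)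

theorem comp_mem_of_adjoin {X Y : Type} {s : Set (Y → ℂ)} {R : Subalgebra ℂ (X → ℂ)} (φ : X → Y)
    (h : ∀ f ∈ s, f ∘ φ ∈ R) : ∀ f ∈ Algebra.adjoin ℂ s, f ∘ φ ∈ R := by
  have : Algebra.adjoin ℂ s ≤ R.comap (pull φ) := Algebra.adjoin_le h
  exact fun f hf => this hf

/-! ### Character varieties of complex linear groups -/

section Complex

variable {n : ℕ} {G : Type} [Group G]

/-- The coordinate ring of `Hom(F_r, G) = G ^ r` for a linear algebraic group `ι : G → GL_n`:
the functions which are polynomial in the entries of the matrices of the generators and of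
their inverses. -/
def repRing (r : ℕ) (ι : G →* GLn n) : Subalgebra ℂ (RepVar r G → ℂ) :=
  Algebra.adjoin ℂ
    ({f | ∃ k i j, f = fun ρ => (ι (ρ.gen k) : Matrix (Fin n) (Fin n) ℂ) i j} ∪
      {f | ∃ k i j, f = fun ρ => (ι (ρ.gen k)⁻¹ : Matrix (Fin n) (Fin n) ℂ) i j})

/-- The ring of invariants `ℂ[Hom(F_r, G)]^G`. -/
def charRing (r : ℕ) (ι : G →* GLn n) : Subalgebra ℂ (RepVar r G → ℂ) where
  carrier := {f | f ∈ repRing r ι ∧ ∀ (g : G) (ρ : RepVar r G), f (g • ρ) = f ρ}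
  mul_mem' ha hb := ⟨mul_mem ha.1 hb.1, fun g ρ => by simp [ha.2 g ρ, hb.2 g ρ]⟩
  add_mem' ha hb := ⟨add_mem ha.1 hb.1, fun g ρ => by simp [ha.2 g ρ, hb.2 g ρ]⟩
  algebraMap_mem' c := ⟨Subalgebra.algebraMap_mem _ c, fun _ _ => rfl⟩

/-- The character variety of `F_r` in the linear algebraic group `ι : G → GL_n`:
the spectrum of the ring of invariants. -/
def charVariety (r : ℕ) (ι : G →* GLn n) : Over (Spec (CommRingCat.of ℂ)) :=
  affine (Reg (charRing r ι))

end Complex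

/-- The standard representation of `GL_n`. -/
abbrev stdGL (n : ℕ) : GLn n →* GLn n := MonoidHom.id _

/-- The standard representation of `SL_n`. -/
abbrev stdSL (n : ℕ) : SLn n →* GLn n := Matrix.SpecialLinearGroup.toGL

/-- The coordinate ring of the torus `(ℂ*)^r`: Laurent polynomials in the coordinates. -/
def torusRing (r : ℕ) : Subalgebra ℂ ((Fin r → ℂˣ) → ℂ) :=
  Algebra.adjoin ℂ
    ({f | ∃ k, f = fun t => ((t k : ℂˣ) : ℂ)} ∪ {f | ∃ k, f = fun t => (((t k)⁻¹ : ℂˣ) : ℂ)})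

/-- `(ζ ρ)(x_k) = ζ_k ρ(x_k)` for `ζ ∈ Z_n^r` and `ρ ∈ Hom(F_r, SL_n)`. -/
def twistSL {r n : ℕ} (ζ : Fin r → Zn n) (ρ : RepVar r (SLn n)) : RepVar r (SLn n) :=
  RepVar.ofTuple fun k => scalarSL n (ζ k) * ρ.gen k

/-- `(t ρ)(x_k) = t_k ρ(x_k)`, a representation in `GL_n`, for `t ∈ (ℂ*)^r` and
`ρ ∈ Hom(F_r, SL_n)`. -/
def scaleGL {r n : ℕ} (t : Fin r → ℂˣ) (ρ : RepVar r (SLn n)) : RepVar r (GLn n) :=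
  RepVar.ofTuple fun k => Matrix.GeneralLinearGroup.scalar (Fin n) (t k) * stdSL n (ρ.gen k)

theorem twistSL_smul {r n : ℕ} (ζ : Fin r → Zn n) (g : SLn n) (ρ : RepVar r (SLn n)) :
    twistSL ζ (g • ρ) = g • twistSL ζ ρ := by
  refine RepVar.ext_gen fun k => ?_
  have h : scalarSL n (ζ k) * g = g * scalarSL n (ζ k) := by
    apply Subtype.ext
    change Matrix.scalar (Fin n) _ * g.1 = g.1 * Matrix.scalar (Fin n) _
    exact (Matrix.scalar_commute _ (fun _ => Commute.all _ _) _).eq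
  simp only [twistSL, RepVar.gen_ofTuple, RepVar.gen_smul]
  rw [← mul_assoc, ← mul_assoc, h]
  group

theorem comp_twistSL_mem {r n : ℕ} (ζ : Fin r → Zn n) :
    ∀ f ∈ charRing r (stdSL n), f ∘ twistSL ζ ∈ charRing r (stdSL n) := by
  rintro f ⟨hf, hinv⟩
  refine ⟨comp_mem_of_adjoin (twistSL ζ) ?_ f hf, fun g ρ => ?_⟩
  · rintro _ (⟨k, i, j, rfl⟩ | ⟨k, i, j, rfl⟩)
    · have h : (fun ρ : RepVar r (SLn n) => (stdSL n (ρ.gen k) : Matrix (Fin n) (Fin n) ℂ) i j)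
          ∈ repRing r (stdSL n) := Algebra.subset_adjoin (Or.inl ⟨k, i, j, rfl⟩)
      convert Subalgebra.smul_mem _ h ((ζ k : ℂˣ) : ℂ) using 1
      funext ρ
      change ((twistSL ζ ρ).gen k).1 i j = ((ζ k : ℂˣ) : ℂ) * (ρ.gen k).1 i j
      rw [twistSL, RepVar.gen_ofTuple]
      change (Matrix.scalar (Fin n) ((ζ k : ℂˣ) : ℂ) * (ρ.gen k).1) i j = _
      simp
    · have h : (fun ρ : RepVar r (SLn n) => (stdSL n (ρ.gen k)⁻¹ : Matrix (Fin n) (Fin n) ℂ) i j)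
          ∈ repRing r (stdSL n) := Algebra.subset_adjoin (Or.inr ⟨k, i, j, rfl⟩)
      convert Subalgebra.smul_mem _ h (((ζ k)⁻¹ : Zn n) : ℂˣ).val using 1
      funext ρ
      change (((twistSL ζ ρ).gen k)⁻¹).1 i j = (((ζ k)⁻¹ : Zn n) : ℂˣ).val * ((ρ.gen k)⁻¹).1 i j
      rw [twistSL, RepVar.gen_ofTuple, mul_inv_rev, ← map_inv]
      change (((ρ.gen k)⁻¹).1 * Matrix.scalar (Fin n) (((ζ k)⁻¹ : Zn n) : ℂˣ).val) i j = _
      simp [mul_comm]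
  · simp only [Function.comp_apply, twistSL_smul, hinv]

theorem comp_torus_mem {r : ℕ} (z : Fin r → ℂˣ) :
    ∀ f ∈ torusRing r, f ∘ (fun t => z * t) ∈ torusRing r := by
  refine comp_mem_of_adjoin _ ?_
  rintro _ (⟨k, rfl⟩ | ⟨k, rfl⟩)
  · have h : (fun t : Fin r → ℂˣ => ((t k : ℂˣ) : ℂ)) ∈ torusRing r :=
      Algebra.subset_adjoin (Or.inl ⟨k, rfl⟩)
    convert Subalgebra.smul_mem _ h ((z k : ℂˣ) : ℂ) using 1
    funext t
    simp
  · have h : (fun t : Fin r → ℂˣ => (((t k)⁻¹ : ℂˣ) : ℂ)) ∈ torusRing r :=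
      Algebra.subset_adjoin (Or.inr ⟨k, rfl⟩)
    convert Subalgebra.smul_mem _ h (((z k)⁻¹ : ℂˣ) : ℂ) using 1
    funext t
    simp [mul_comm]

theorem comp_pow_mem (r n : ℕ) :
    ∀ f ∈ torusRing r, f ∘ (fun t => t ^ n) ∈ torusRing r := by
  refine comp_mem_of_adjoin _ ?_
  rintro _ (⟨k, rfl⟩ | ⟨k, rfl⟩)
  · have h : (fun t : Fin r → ℂˣ => ((t k : ℂˣ) : ℂ)) ∈ torusRing r :=
      Algebra.subset_adjoin (Or.inl ⟨k, rfl⟩)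
    convert Subalgebra.pow_mem _ h n using 1
    funext t
    simp
  · have h : (fun t : Fin r → ℂˣ => (((t k)⁻¹ : ℂˣ) : ℂ)) ∈ torusRing r :=
      Algebra.subset_adjoin (Or.inr ⟨k, rfl⟩)
    convert Subalgebra.pow_mem _ h n using 1
    funext t
    simp

/-- `det ρ = (det ρ(x_1), …, det ρ(x_r))`. -/
def detRep {r n : ℕ} (ρ : RepVar r (GLn n)) : Fin r → ℂˣ :=
  fun k => Matrix.GeneralLinearGroup.det (ρ.gen k)

theorem comp_detRep_mem (r n : ℕ) :
    ∀ f ∈ torusRing r, f ∘ detRep ∈ charRing r (stdGL n) := by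
  refine comp_mem_of_adjoin _ ?_
  rintro _ (⟨k, rfl⟩ | ⟨k, rfl⟩)
  · refine ⟨?_, fun g ρ => by simp [detRep]⟩
    have : ((fun t : Fin r → ℂˣ => ((t k : ℂˣ) : ℂ)) ∘ detRep) =
        ∑ σ : Equiv.Perm (Fin n), ((Equiv.Perm.sign σ : ℤ) : ℂ) • ∏ i,
          (fun ρ : RepVar r (GLn n) => (stdGL n (ρ.gen k) : Matrix (Fin n) (Fin n) ℂ) (σ i) i) := by
      funext ρ
      simp [detRep, Matrix.det_apply', Finset.sum_apply, Finset.prod_apply]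
    rw [this]
    exact Subalgebra.sum_mem (repRing r (stdGL n)) fun σ _ => Subalgebra.smul_mem _ (Subalgebra.prod_mem (repRing r (stdGL n)) fun i _ =>
      Algebra.subset_adjoin (Or.inl ⟨k, σ i, i, rfl⟩)) _
  · refine ⟨?_, fun g ρ => by simp [detRep]⟩
    have : ((fun t : Fin r → ℂˣ => (((t k)⁻¹ : ℂˣ) : ℂ)) ∘ detRep) =
        ∑ σ : Equiv.Perm (Fin n), ((Equiv.Perm.sign σ : ℤ) : ℂ) • ∏ i,
          (fun ρ : RepVar r (GLn n) =>
            (stdGL n (ρ.gen k)⁻¹ : Matrix (Fin n) (Fin n) ℂ) (σ i) i) := by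
      funext ρ
      simp only [detRep, Function.comp_apply, ← map_inv, Matrix.GeneralLinearGroup.val_det_apply,
        Matrix.det_apply']
      simp [Finset.sum_apply, Finset.prod_apply]
    rw [this]
    exact Subalgebra.sum_mem (repRing r (stdGL n)) fun σ _ => Subalgebra.smul_mem _ (Subalgebra.prod_mem (repRing r (stdGL n)) fun i _ =>
      Algebra.subset_adjoin (Or.inr ⟨k, σ i, i, rfl⟩)) _

/-- The coordinate ring of `X_r(SL_n) × (ℂ*)^r`. -/
abbrev prodRing (r n : ℕ) : Type := Reg (charRing r (stdSL n)) ⊗[ℂ] Reg (torusRing r)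

/-- `ζ ∈ Z_n^r` acts on `X_r(SL_n) × (ℂ*)^r` by `ζ · ([ρ], t) = ([ζ ρ], ζ⁻¹ t)`; this is the
induced endomorphism of the coordinate ring. -/
def actProd {r n : ℕ} (ζ : Fin r → Zn n) : prodRing r n →ₐ[ℂ] prodRing r n :=
  Algebra.TensorProduct.map
    (pullReg (twistSL ζ) (comp_twistSL_mem ζ))
    (pullReg (fun t => (fun k => ((ζ k : ℂˣ))⁻¹) * t) (comp_torus_mem _))

/-- The `Z_n^r`-invariant regular functions on `X_r(SL_n) × (ℂ*)^r`. -/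
def twistedRing (r n : ℕ) : Subalgebra ℂ (prodRing r n) :=
  ⨅ ζ : Fin r → Zn n, AlgHom.equalizer (actProd ζ) (AlgHom.id ℂ (prodRing r n))

/-- The twisted product `X_r(SL_n) ×_{Z_n^r} (ℂ*)^r`, i.e. the quotient
`(X_r(SL_n) × (ℂ*)^r) // Z_n^r`. -/
def twistedGL (r n : ℕ) : Over (Spec (CommRingCat.of ℂ)) := affine (twistedRing r n)

/-- The quotient morphism `X_r(SL_n) × (ℂ*)^r → X_r(SL_n) ×_{Z_n^r} (ℂ*)^r`. -/
def quotGL (r n : ℕ) : affine (prodRing r n) ⟶ twistedGL r n := affineMap (twistedRing r n).val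

/-- The projection `X_r(SL_n) × (ℂ*)^r → (ℂ*)^r`. -/
def projTorus (r n : ℕ) : affine (prodRing r n) ⟶ affine (Reg (torusRing r)) :=
  affineMap Algebra.TensorProduct.includeRight

/-- The `n`-th power map of the torus `(ℂ*)^r`. -/
def powTorus (r n : ℕ) : affine (Reg (torusRing r)) ⟶ affine (Reg (torusRing r)) :=
  affineMap (pullReg (fun t => t ^ n) (comp_pow_mem r n))

/-- The determinant map `X_r(GL_n) → (ℂ*)^r`. -/
def detGL (r n : ℕ) : charVariety r (stdGL n) ⟶ affine (Reg (torusRing r)) :=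
  affineMap (pullReg detRep (comp_detRep_mem r n))

/-- The point `[ρ]` of `X_r(GL_n)`. -/
def ptGL {r n : ℕ} (ρ : RepVar r (GLn n)) : affine ℂ ⟶ charVariety r (stdGL n) :=
  affineMap (evalReg (charRing r (stdGL n)) ρ)

/-- The point `([ρ], t)` of `X_r(SL_n) × (ℂ*)^r`. -/
def ptProd {r n : ℕ} (ρ : RepVar r (SLn n)) (t : Fin r → ℂˣ) :
    affine ℂ ⟶ affine (prodRing r n) :=
  affineMap (Algebra.TensorProduct.productMap (evalReg (charRing r (stdSL n)) ρ)
    (evalReg (torusRing r) t))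

/-! ### Semi-algebraic sets and their quotients -/

/-- Semi-algebraic subsets of `ℝ^ι`: the Boolean algebra generated by the sets `{p > 0}`, `p` a
real polynomial. -/
inductive IsSemialgebraic {ι : Type} : Set (ι → ℝ) → Prop
  | pos (p : MvPolynomial ι ℝ) : IsSemialgebraic {x | 0 < MvPolynomial.eval x p}
  | compl {S : Set (ι → ℝ)} : IsSemialgebraic S → IsSemialgebraic Sᶜ
  | union {S T : Set (ι → ℝ)} : IsSemialgebraic S → IsSemialgebraic T → IsSemialgebraic (S ∪ T)

namespace IsSemialgebraic

variable {ι κ : Type}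

theorem inter {S T : Set (ι → ℝ)} (hS : IsSemialgebraic S) (hT : IsSemialgebraic T) :
    IsSemialgebraic (S ∩ T) := by
  rw [← compl_compl (S ∩ T), Set.compl_inter]
  exact (hS.compl.union hT.compl).compl

theorem univ : IsSemialgebraic (Set.univ : Set (ι → ℝ)) := by
  convert IsSemialgebraic.pos (1 : MvPolynomial ι ℝ) using 1
  ext x
  simp

theorem zero (p : MvPolynomial ι ℝ) : IsSemialgebraic {x | MvPolynomial.eval x p = 0} := by
  convert ((pos p).union (pos (-p))).compl using 1
  ext x
  simp only [map_neg, Set.mem_ofPred_eq, Set.mem_compl_iff, Set.mem_union]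
  constructor
  · intro h
    simp [h]
  · intro h
    push Not at h
    linarith

theorem iInter {α : Type} [Finite α] {S : α → Set (ι → ℝ)} (h : ∀ a, IsSemialgebraic (S a)) :
    IsSemialgebraic (⋂ a, S a) := by
  classical
  have := Fintype.ofFinite α
  have key : ∀ s : Finset α, IsSemialgebraic (⋂ a ∈ s, S a) := by
    intro s
    induction s using Finset.induction_on with
    | empty => simpa using univ
    | insert a s _ ih =>
      rw [Finset.set_biInter_insert]
      exact (h a).inter ih
  simpa using key Finset.univ

/-- Reindexing of coordinates. -/
theorem preimage_comp {S : Set (ι → ℝ)} (hS : IsSemialgebraic S) (e : ι → κ) :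
    IsSemialgebraic {x : κ → ℝ | x ∘ e ∈ S} := by
  induction hS with
  | pos p =>
    convert pos (MvPolynomial.rename e p) using 1
    ext x
    simp [MvPolynomial.eval_rename]
  | compl _ ih => exact ih.compl
  | union _ _ ih₁ ih₂ => exact ih₁.union ih₂

/-- The real zero set of a complex polynomial is semi-algebraic. -/
theorem complexZero (P : MvPolynomial ι ℂ) :
    IsSemialgebraic {x : ι → ℝ | MvPolynomial.eval (fun i => (x i : ℂ)) P = 0} := by
  have key : ∃ p q : MvPolynomial ι ℝ, ∀ x : ι → ℝ,
      MvPolynomial.eval (fun i => (x i : ℂ)) P =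
        ⟨MvPolynomial.eval x p, MvPolynomial.eval x q⟩ := by
    induction P using MvPolynomial.induction_on with
    | C a => exact ⟨MvPolynomial.C a.re, MvPolynomial.C a.im, fun x => by simp⟩
    | add P Q hP hQ =>
      obtain ⟨p, q, h⟩ := hP
      obtain ⟨p', q', h'⟩ := hQ
      exact ⟨p + p', q + q', fun x => by simp [h, h', Complex.ext_iff]⟩
    | mul_X P i hP =>
      obtain ⟨p, q, h⟩ := hP
      exact ⟨p * MvPolynomial.X i, q * MvPolynomial.X i, fun x => by
        simp [h, Complex.ext_iff]⟩
  obtain ⟨p, q, h⟩ := key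
  convert (zero p).inter (zero q) using 1
  ext x
  simp [h, Complex.ext_iff]

end IsSemialgebraic

/-- A presentation of `X` as a quotient of a semi-algebraic set: a semi-algebraic subset of some
`ℝ^ι` (parametrised bijectively by `carrier`) together with a surjection onto `X`. A subset of `X`
is semi-algebraic when its preimage is; by the Tarski-Seidenberg theorem this is the structure of
the image of the semi-algebraic set whenever `X` is realised in some `ℝ^m` such that the surjection
becomes a semi-algebraic map. -/
structure SemialgQuotient (X : Type) where
  carrier : Type
  ι : Type
  finite : Finite ι
  coord : carrier → ι → ℝ
  coord_injective : Function.Injective coord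
  range_coord : IsSemialgebraic (Set.range coord)
  proj : carrier → X
  proj_surjective : Function.Surjective proj

namespace SemialgQuotient

/-- The structure induced on a further quotient. -/
def map {X Y : Type} (P : SemialgQuotient X) (f : X → Y) (hf : Function.Surjective f) :
    SemialgQuotient Y :=
  { P with
    proj := f ∘ P.proj
    proj_surjective := hf.comp P.proj_surjective }

/-- The product structure. -/
def prod {X Y : Type} (P : SemialgQuotient X) (Q : SemialgQuotient Y) :
    SemialgQuotient (X × Y) where
  carrier := P.carrier × Q.carrier
  ι := P.ι ⊕ Q.ι
  finite := by
    have := P.finite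
    have := Q.finite
    infer_instance
  coord a := Sum.elim (P.coord a.1) (Q.coord a.2)
  coord_injective a b h := by
    refine Prod.ext (P.coord_injective ?_) (Q.coord_injective ?_)
    · funext i
      exact congrFun h (Sum.inl i)
    · funext i
      exact congrFun h (Sum.inr i)
  range_coord := by
    convert (P.range_coord.preimage_comp Sum.inl).inter (Q.range_coord.preimage_comp Sum.inr)
      using 1
    ext x
    constructor
    · rintro ⟨a, rfl⟩
      exact ⟨⟨a.1, rfl⟩, ⟨a.2, rfl⟩⟩
    · rintro ⟨⟨a, ha⟩, ⟨b, hb⟩⟩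
      refine ⟨(a, b), ?_⟩
      simp only [ha, hb]
      exact Sum.elim_comp_inl_inr x
  proj := Prod.map P.proj Q.proj
  proj_surjective := P.proj_surjective.prodMap Q.proj_surjective

/-- A map is semi-algebraic when its graph is a semi-algebraic subset of the product. -/
def IsSemialgMap {X Y : Type} (P : SemialgQuotient X) (Q : SemialgQuotient Y) (f : X → Y) : Prop :=
  IsSemialgebraic ((P.prod Q).coord '' {c | f ((P.prod Q).proj c).1 = ((P.prod Q).proj c).2})

end SemialgQuotient

/-! ### Character varieties of compact groups -/

/-- The real coordinates of a complex number. -/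
def reIm (z : ℂ) (b : Bool) : ℝ := bif b then z.im else z.re

/-- The matrix with given real and imaginary parts of its entries. -/
def matOf {n : ℕ} (x : Fin n × Fin n × Bool → ℝ) : Matrix (Fin n) (Fin n) ℂ :=
  Matrix.of fun i j => ⟨x (i, j, false), x (i, j, true)⟩

/-- `Hom(F_r, K) = K ^ r`, for a group `K` of complex matrices which is a semi-algebraic set, with
the real and imaginary parts of the entries of the generators as coordinates. -/
def repSemialg (r : ℕ) {n : ℕ} (K : Submonoid (Matrix (Fin n) (Fin n) ℂ)) [Group K]
    (hK : IsSemialgebraic {x : Fin n × Fin n × Bool → ℝ | matOf x ∈ K}) :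
    SemialgQuotient (RepVar r K) where
  carrier := RepVar r K
  ι := Fin r × Fin n × Fin n × Bool
  finite := inferInstance
  coord ρ i := reIm ((ρ.gen i.1).1 i.2.1 i.2.2.1) i.2.2.2
  coord_injective ρ σ h := by
    refine RepVar.ext_gen fun k => Subtype.ext (Matrix.ext fun i j => Complex.ext ?_ ?_)
    · exact congrFun h (k, i, j, false)
    · exact congrFun h (k, i, j, true)
  range_coord := by
    convert IsSemialgebraic.iInter fun k : Fin r =>
      hK.preimage_comp (fun i : Fin n × Fin n × Bool => (k, i)) using 1
    ext x
    simp only [Set.mem_range, Set.mem_iInter, Set.mem_ofPred_eq]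
    constructor
    · rintro ⟨ρ, rfl⟩ k
      change matOf (fun i : Fin n × Fin n × Bool => reIm ((ρ.gen k).1 i.1 i.2.1) i.2.2) ∈ K
      convert (ρ.gen k).2 using 1
      ext i j
      simp [matOf, reIm]
    · intro h
      refine ⟨RepVar.ofTuple fun k => ⟨_, h k⟩, ?_⟩
      funext ⟨k, i, j, b⟩
      cases b <;> simp [reIm, matOf]
  proj := id
  proj_surjective := Function.surjective_id

section

variable (n : ℕ)

/-- The generic complex matrix, as a polynomial in real coordinates. -/
def genMat : Matrix (Fin n) (Fin n) (MvPolynomial (Fin n × Fin n × Bool) ℂ) :=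
  Matrix.of fun i j => MvPolynomial.X (i, j, false) +
    MvPolynomial.C Complex.I * MvPolynomial.X (i, j, true)

/-- The conjugate transpose of the generic complex matrix. -/
def genMatStar : Matrix (Fin n) (Fin n) (MvPolynomial (Fin n × Fin n × Bool) ℂ) :=
  Matrix.of fun i j => MvPolynomial.X (j, i, false) -
    MvPolynomial.C Complex.I * MvPolynomial.X (j, i, true)

theorem eval_genMat (x : Fin n × Fin n × Bool → ℝ) :
    (MvPolynomial.eval fun i => (x i : ℂ)).mapMatrix (genMat n) = matOf x := by
  ext i j
  simp [genMat, matOf, Complex.ext_iff]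

theorem eval_genMatStar (x : Fin n × Fin n × Bool → ℝ) :
    (MvPolynomial.eval fun i => (x i : ℂ)).mapMatrix (genMatStar n) = star (matOf x) := by
  ext i j
  simp [genMatStar, matOf, Complex.ext_iff, Matrix.star_apply]

theorem semialg_unitary :
    IsSemialgebraic {x : Fin n × Fin n × Bool → ℝ | matOf x ∈ Matrix.unitaryGroup (Fin n) ℂ} := by
  convert IsSemialgebraic.iInter fun ij : Fin n × Fin n =>
    IsSemialgebraic.complexZero ((genMat n * genMatStar n - 1) ij.1 ij.2) using 1
  ext x
  have h : ∀ i j, MvPolynomial.eval (fun i => (x i : ℂ)) ((genMat n * genMatStar n - 1) i j) =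
      (matOf x * star (matOf x) - 1) i j := by
    intro i j
    rw [← eval_genMatStar, ← eval_genMat, ← map_mul,
      ← map_one (MvPolynomial.eval fun i => (x i : ℂ)).mapMatrix, ← map_sub]
    rfl
  simp only [Set.mem_ofPred_eq, Set.mem_iInter, h, Matrix.mem_unitaryGroup_iff, Prod.forall]
  rw [← sub_eq_zero]
  exact ⟨fun h i j => by rw [h]; rfl, fun h => Matrix.ext h⟩

theorem semialg_specialUnitary :
    IsSemialgebraic
      {x : Fin n × Fin n × Bool → ℝ | matOf x ∈ Matrix.specialUnitaryGroup (Fin n) ℂ} := by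
  convert (semialg_unitary n).inter (IsSemialgebraic.complexZero ((genMat n).det - 1)) using 1
  ext x
  have h : MvPolynomial.eval (fun i => (x i : ℂ)) ((genMat n).det - 1) = (matOf x).det - 1 := by
    rw [map_sub, map_one, RingHom.map_det, eval_genMat]
  simp only [Set.mem_ofPred_eq, Set.mem_inter_iff, h, Matrix.mem_specialUnitaryGroup_iff,
    sub_eq_zero]

end

/-- The torus `(S¹)^r` as a semi-algebraic set. -/
def torusSemialg (r : ℕ) : SemialgQuotient (Fin r → Circle) where
  carrier := Fin r → Circle
  ι := Fin r × Bool
  finite := inferInstance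
  coord t i := reIm (t i.1) i.2
  coord_injective s t h := by
    refine funext fun k => Circle.ext (Complex.ext ?_ ?_)
    · exact congrFun h (k, false)
    · exact congrFun h (k, true)
  range_coord := by
    convert IsSemialgebraic.iInter fun k : Fin r => IsSemialgebraic.zero
      (MvPolynomial.X (k, false) * MvPolynomial.X (k, false) +
        MvPolynomial.X (k, true) * MvPolynomial.X (k, true) - 1 :
          MvPolynomial (Fin r × Bool) ℝ) using 1
    ext x
    simp only [Set.mem_range, Set.mem_iInter, Set.mem_ofPred_eq, map_sub, map_add, map_mul,
      MvPolynomial.eval_X, map_one, sub_eq_zero]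
    constructor
    · rintro ⟨t, rfl⟩ k
      simpa [reIm, Complex.normSq_apply] using Circle.normSq_coe (t k)
    · intro h
      refine ⟨fun k => ⟨⟨x (k, false), x (k, true)⟩, ?_⟩, ?_⟩
      · rw [Submonoid.unitSphere, Submonoid.mem_mk, Subsemigroup.mem_mk, mem_sphere_zero_iff_norm,
          Complex.norm_def, Complex.normSq_mk, h k, Real.sqrt_one]
      · funext ⟨k, b⟩
        cases b <;> simp [reIm]
  proj := id
  proj_surjective := Function.surjective_id

/-- The character variety of `F_r` in a compact group: the space of conjugation orbits, with the
quotient topology. -/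
abbrev orbitSpace (r : ℕ) (K : Type) [Group K] : Type := MulAction.orbitRel.Quotient K (RepVar r K)

/-- The class of a representation. -/
def cls {r : ℕ} {K : Type} [Group K] (ρ : RepVar r K) : orbitSpace r K := Quotient.mk _ ρ

theorem cls_surjective {r : ℕ} {K : Type} [Group K] :
    Function.Surjective (cls : RepVar r K → orbitSpace r K) := Quotient.mk_surjective

theorem cls_smul {r : ℕ} {K : Type} [Group K] (g : K) (ρ : RepVar r K) : cls (g • ρ) = cls ρ :=
  Quotient.sound (MulAction.mem_orbit ρ g)

/-- `X_r(U(n))` as a semi-algebraic set. -/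
def semialgU (r n : ℕ) : SemialgQuotient (orbitSpace r (Un n)) :=
  (repSemialg r (Matrix.unitaryGroup (Fin n) ℂ) (semialg_unitary n)).map cls cls_surjective

/-- `X_r(SU(n))` as a semi-algebraic set. -/
def semialgSU (r n : ℕ) : SemialgQuotient (orbitSpace r (SUn n)) :=
  (repSemialg r (Matrix.specialUnitaryGroup (Fin n) ℂ) (semialg_specialUnitary n)).map cls
    cls_surjective

/-- `(ζ ρ)(x_k) = ζ_k ρ(x_k)` for `ζ ∈ Z_n^r` and `ρ ∈ Hom(F_r, SU(n))`. -/
def twistSU {r n : ℕ} [NeZero n] (ζ : Fin r → Zn n) (ρ : RepVar r (SUn n)) : RepVar r (SUn n) :=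
  RepVar.ofTuple fun k => scalarSU n (ζ k) * ρ.gen k

/-- `(t ρ)(x_k) = t_k ρ(x_k)`, a representation in `U(n)`, for `t ∈ (S¹)^r` and
`ρ ∈ Hom(F_r, SU(n))`. -/
def scaleU {r n : ℕ} (t : Fin r → Circle) (ρ : RepVar r (SUn n)) : RepVar r (Un n) :=
  RepVar.ofTuple fun k => scalarU n (t k) * inclSU n (ρ.gen k)

section Twisted

variable {r n : ℕ} [NeZero n]

theorem twistSU_smul (ζ : Fin r → Zn n) (g : SUn n) (ρ : RepVar r (SUn n)) :
    twistSU ζ (g • ρ) = g • twistSU ζ ρ := by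
  refine RepVar.ext_gen fun k => ?_
  have h : scalarSU n (ζ k) * g = g * scalarSU n (ζ k) := by
    apply Subtype.ext
    change Matrix.scalar (Fin n) _ * g.1 = g.1 * Matrix.scalar (Fin n) _
    exact (Matrix.scalar_commute _ (fun _ => Commute.all _ _) _).eq
  simp only [twistSU, RepVar.gen_ofTuple, RepVar.gen_smul]
  rw [← mul_assoc, ← mul_assoc, h]
  group

/-- The action of `Z_n^r` on `X_r(SU(n))`. -/
def twistClass (ζ : Fin r → Zn n) : orbitSpace r (SUn n) → orbitSpace r (SUn n) :=
  Quotient.lift (fun ρ => cls (twistSU ζ ρ)) (by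
    rintro _ ρ ⟨g, rfl⟩
    change cls (twistSU ζ (g • ρ)) = _
    rw [twistSU_smul, cls_smul])

@[simp] theorem twistClass_cls (ζ : Fin r → Zn n) (ρ : RepVar r (SUn n)) :
    twistClass ζ (cls ρ) = cls (twistSU ζ ρ) := rfl

/-- The action of `Z_n^r` on `X_r(SU(n)) × (S¹)^r`: `ζ · ([ρ], t) = ([ζ ρ], ζ⁻¹ t)`. -/
@[reducible]
def prodAction : MulAction (Fin r → Zn n) (orbitSpace r (SUn n) × (Fin r → Circle)) where
  smul ζ p := (twistClass ζ p.1, fun k => (rootsOfUnitytoCircle n (ζ k))⁻¹ * p.2 k)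
  one_smul p := by
    obtain ⟨x, t⟩ := p
    obtain ⟨ρ, rfl⟩ := cls_surjective x
    refine Prod.ext ?_ ?_
    · change cls (twistSU 1 ρ) = cls ρ
      congr 1
      exact RepVar.ext_gen fun k => by simp [twistSU]
    · funext k
      change (rootsOfUnitytoCircle n 1)⁻¹ * t k = t k
      simp
  mul_smul ζ η p := by
    obtain ⟨x, t⟩ := p
    obtain ⟨ρ, rfl⟩ := cls_surjective x
    refine Prod.ext ?_ ?_
    · change cls (twistSU (ζ * η) ρ) = cls (twistSU ζ (twistSU η ρ))
      congr 1
      exact RepVar.ext_gen fun k => by simp [twistSU, mul_assoc]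
    · funext k
      change (rootsOfUnitytoCircle n (ζ k * η k))⁻¹ * t k =
        (rootsOfUnitytoCircle n (ζ k))⁻¹ * ((rootsOfUnitytoCircle n (η k))⁻¹ * t k)
      rw [map_mul, mul_inv, mul_assoc]

end Twisted

/-- The twisted product `X_r(SU(n)) ×_{Z_n^r} (S¹)^r`: the orbit space of the action of `Z_n^r`
on `X_r(SU(n)) × (S¹)^r`, with the quotient topology. -/
def TwistedU (r n : ℕ) [NeZero n] : Type :=
  letI := prodAction (r := r) (n := n)
  MulAction.orbitRel.Quotient (Fin r → Zn n) (orbitSpace r (SUn n) × (Fin r → Circle))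

/-- The quotient map `X_r(SU(n)) × (S¹)^r → X_r(SU(n)) ×_{Z_n^r} (S¹)^r`. -/
def quotU (r n : ℕ) [NeZero n] (p : orbitSpace r (SUn n) × (Fin r → Circle)) : TwistedU r n :=
  letI := prodAction (r := r) (n := n)
  Quotient.mk (MulAction.orbitRel (Fin r → Zn n) _) p

theorem quotU_surjective (r n : ℕ) [NeZero n] : Function.Surjective (quotU r n) :=
  Quotient.mk_surjective

instance (r n : ℕ) [NeZero n] : TopologicalSpace (TwistedU r n) :=
  TopologicalSpace.coinduced (quotU r n) inferInstance

/-- `X_r(SU(n)) ×_{Z_n^r} (S¹)^r` as a semi-algebraic set. -/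
def semialgTwistedU (r n : ℕ) [NeZero n] : SemialgQuotient (TwistedU r n) :=
  ((semialgSU r n).prod (torusSemialg r)).map (quotU r n) (quotU_surjective r n)

/-- The determinant map `X_r(U(n)) → (S¹)^r`. -/
def detClassU (r n : ℕ) : orbitSpace r (Un n) → (Fin r → Circle) :=
  Quotient.lift (fun ρ k => detU n (ρ.gen k)) (by
    rintro _ ρ ⟨g, rfl⟩
    funext k
    change detU n ((g • ρ).gen k) = _
    simp)

end CharVar

end

open CharVar

noncomputable section

namespace CharVar

/-! ### Regular functions on products -/

section Product

variable {X Y : Type}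

/-! The complex half is character theory of the finite group `Z_n^r`, carried out on honest
functions on `Hom(F_r, SL_n) × (ℂ*)^r`. A tensor product of function algebras over a field embeds in
the functions on the product (`tensorFun_injective`), so an element of `prodRing` may be treated as
a function of `(ρ, t)`. Invariants for `GL_n` embed there too, by pull-back along `(ρ, t) ↦ t ρ`:
this map is onto because a determinant has an `n`-th root.

The isomorphism is the equality of two subalgebras of that function ring (`charFun_range`). One
inclusion holds because `t ρ` does not change under `(ζ ρ, ζ⁻¹ t)`. For the other, a
`Z_n^r`-invariant function is its own average, and `exists_avg_eq` computes averages monomial by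
monomial: a monomial of weight `a` averages to zero unless `n` divides `a`, and then it equals a
polynomial in the entries of `t ρ` and of their inverses, divided by a power of `det (t ρ) = t^n`.
Conjugation by `GL_n` and by `SL_n` gives the same orbits, since scalars act trivially, so the
result is invariant under `GL_n`.

The square is Cartesian because the monomials `t^a` with `0 ≤ a_k < n` span the ring of the torus
over itself via the `n`-th power map and form a basis of the product ring over the ring of
`X_r(GL_n)`. Existence and uniqueness of the expansion (`prod_exists_sum`, `prod_sum_eq_zero`) are
Fourier inversion and orthogonality on `Z_n^r`; `isPushout_of_basis` turns them into a pushout of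
rings.

In the compact half, equality of `s ρ` and `t σ` forces `s^n = t^n` by determinants, hence a twist
by roots of unity (`exists_twist_of_scaleU_eq`). The resulting continuous bijection is a
homeomorphism because a continuous surjection from a compact space to a Hausdorff one is a quotient
map. Its graph is semi-algebraic because finitely many polynomial equations decide whether two
unitary representations are conjugate (`exists_finset_mem_orbit_iff`): invariant polynomials
separate compact orbits, by Stone-Weierstrass and Haar averaging, and Hilbert's basis theorem
reduces them to a finite set. Local continuous sections of the `n`-th power map trivialize the
determinant. -/

@[ext] theorem Reg.ext {R : Subalgebra ℂ (X → ℂ)} {f g : Reg R}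
    (h : ∀ x, Reg.toFun R f x = Reg.toFun R g x) : f = g :=
  Subtype.ext (funext h)

/-- The function on `X × Y` defined by an element of the tensor product of two algebras of
functions. -/
def tensorFun (R : Subalgebra ℂ (X → ℂ)) (S : Subalgebra ℂ (Y → ℂ)) :
    Reg R ⊗[ℂ] Reg S →ₐ[ℂ] (X × Y → ℂ) :=
  Algebra.TensorProduct.productMap ((pull Prod.fst).comp (Reg.toFun R))
    ((pull Prod.snd).comp (Reg.toFun S))

@[simp] theorem tensorFun_tmul (R : Subalgebra ℂ (X → ℂ)) (S : Subalgebra ℂ (Y → ℂ))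
    (f : Reg R) (g : Reg S) (p : X × Y) :
    tensorFun R S (f ⊗ₜ g) p = Reg.toFun R f p.1 * Reg.toFun S g p.2 := rfl

/-- Linear functionals separate the points of `V`, and applying one turns the hypothesis into a
linear relation among the basis functions. Allowing an arbitrary `V` lets the lemma be used both for
`Reg R` and for a quotient of a function space. -/
theorem eq_zero_of_forall_sum_basis {S : Subalgebra ℂ (Y → ℂ)} {κ : Type}
    (b : Module.Basis κ ℂ (Reg S)) {V : Type} [AddCommGroup V] [Module ℂ V] (c : κ →₀ V)
    (h : ∀ y, (c.sum fun i v => Reg.toFun S (b i) y • v) = 0) : c = 0 := by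
  ext i
  refine (Module.forall_dual_apply_eq_zero_iff ℂ _).1 fun l => ?_
  have key : (∑ i ∈ c.support, l (c i) • b i) = 0 := by
    ext y
    have := congrArg l (h y)
    simpa [Finsupp.sum, mul_comm] using this
  by_cases hi : i ∈ c.support
  · exact linearIndependent_iff'.1 b.linearIndependent _ (fun i => l (c i)) key i hi
  · simp [Finsupp.notMem_support_iff.1 hi]

theorem exists_tensor_eq_sum (R : Subalgebra ℂ (X → ℂ)) {S : Subalgebra ℂ (Y → ℂ)} {κ : Type}
    (b : Module.Basis κ ℂ (Reg S)) (z : Reg R ⊗[ℂ] Reg S) :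
    ∃ c : κ →₀ Reg R, z = c.sum fun i f => f ⊗ₜ b i := by
  classical
  refine ⟨TensorProduct.equivFinsuppOfBasisRight b z, ?_⟩
  have := LinearMap.congr_fun (TensorProduct.equivFinsuppOfBasisRight_symm (M := Reg R) b)
    (TensorProduct.equivFinsuppOfBasisRight b z)
  simpa [Finsupp.sum] using this

theorem tensorFun_injective (R : Subalgebra ℂ (X → ℂ)) (S : Subalgebra ℂ (Y → ℂ)) :
    Function.Injective (tensorFun R S) := by
  rw [injective_iff_map_eq_zero]
  intro z hz
  obtain ⟨c, rfl⟩ := exists_tensor_eq_sum R (Module.Basis.ofVectorSpace ℂ (Reg S)) z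
  rw [eq_zero_of_forall_sum_basis (Module.Basis.ofVectorSpace ℂ (Reg S)) c fun y => ?_]
  · simp
  · ext x
    have := congrFun hz (x, y)
    simpa [Finsupp.sum, mul_comm] using this

theorem tensorFun_slice_mem {R : Subalgebra ℂ (X → ℂ)} {S : Subalgebra ℂ (Y → ℂ)}
    (z : Reg R ⊗[ℂ] Reg S) (y : Y) : (fun x => tensorFun R S z (x, y)) ∈ R := by
  have h : (pull fun x : X => (x, y)).comp (tensorFun R S) =
      Algebra.TensorProduct.productMap (Reg.toFun R)
        ((Algebra.ofId ℂ _).comp (evalReg S y)) :=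
    Algebra.TensorProduct.ext' fun f s => rfl
  have hz := AlgHom.congr_fun h z
  change (fun x => tensorFun R S z (x, y)) = _ at hz
  rw [hz]
  have hle : (Algebra.TensorProduct.productMap (Reg.toFun R)
      ((Algebra.ofId ℂ _).comp (evalReg S y))).range ≤ R := by
    rw [Algebra.TensorProduct.productMap_range, sup_le_iff]
    constructor
    · rintro _ ⟨f, rfl⟩
      exact f.2
    · rintro _ ⟨f, rfl⟩
      exact Subalgebra.algebraMap_mem _ _
  exact hle ⟨z, rfl⟩

/-- When a tensor is expanded in a basis of `S`, its slices determine its coefficients, so the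
coefficients inherit membership in `R'`. No inclusion between `R` and `R'` is assumed; this allows
passage in both directions between all functions on the representation space and the invariant ones.
-/
theorem tensorFun_mem_range_of_slices {R R' : Subalgebra ℂ (X → ℂ)} {S : Subalgebra ℂ (Y → ℂ)}
    (z : Reg R ⊗[ℂ] Reg S) (hz : ∀ y, (fun x => tensorFun R S z (x, y)) ∈ R') :
    tensorFun R S z ∈ (tensorFun R' S).range := by
  obtain ⟨c, rfl⟩ := exists_tensor_eq_sum R (Module.Basis.ofVectorSpace ℂ (Reg S)) z
  set b := Module.Basis.ofVectorSpace ℂ (Reg S)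
  -- The coefficients are read modulo `R'`; there every slice vanishes, so every coefficient does.
  have hc : c.mapRange (fun f => (Subalgebra.toSubmodule R').mkQ (Reg.toFun R f)) (by simp) = 0 := by
    refine eq_zero_of_forall_sum_basis b _ fun y => ?_
    rw [Finsupp.sum_mapRange_index (by simp), Finsupp.sum]
    simp only [← map_smul, ← map_sum]
    rw [Submodule.mkQ_apply, Submodule.Quotient.mk_eq_zero]
    convert hz y using 1
    have : Reg.toFun R (∑ i ∈ c.support, Reg.toFun S (b i) y • c i) =
        fun x => tensorFun R S (c.sum fun i f => f ⊗ₜ b i) (x, y) := by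
      ext x
      simp [Finsupp.sum, mul_comm]
    rw [this]
    rfl
  have hmem : ∀ i, Reg.toFun R (c i) ∈ R' := fun i => by
    have := DFunLike.congr_fun hc i
    rw [Finsupp.mapRange_apply] at this
    simpa using this
  refine ⟨∑ i ∈ c.support, (show Reg R' from ⟨_, hmem i⟩) ⊗ₜ b i, ?_⟩
  ext p
  simp only [map_sum, Finset.sum_apply, Finsupp.sum]
  rfl

end Product

/-! ### The torus -/

/-- The characters of the torus. -/
def torusChar {r : ℕ} (a : Fin r → ℤ) : (Fin r → ℂˣ) →* ℂˣ where
  toFun t := ∏ k, t k ^ a k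
  map_one' := by simp
  map_mul' s t := by simp [mul_zpow, Finset.prod_mul_distrib]

theorem torusChar_apply {r : ℕ} (a : Fin r → ℤ) (t : Fin r → ℂˣ) :
    torusChar a t = ∏ k, t k ^ a k := rfl

theorem torusChar_add {r : ℕ} (a b : Fin r → ℤ) (t : Fin r → ℂˣ) :
    torusChar (a + b) t = torusChar a t * torusChar b t := by
  simp [torusChar_apply, zpow_add, Finset.prod_mul_distrib]

theorem torusChar_neg {r : ℕ} (a : Fin r → ℤ) (t : Fin r → ℂˣ) :
    torusChar (-a) t = (torusChar a t)⁻¹ := by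
  simp [torusChar_apply]

@[simp] theorem torusChar_zero {r : ℕ} (t : Fin r → ℂˣ) : torusChar 0 t = 1 := by
  simp [torusChar_apply]

theorem torusChar_single {r : ℕ} (k : Fin r) (t : Fin r → ℂˣ) :
    torusChar (Pi.single k 1) t = t k := by
  rw [torusChar_apply, Finset.prod_eq_single k] <;> simp +contextual

theorem torusChar_pow {r : ℕ} (a : Fin r → ℤ) (t : Fin r → ℂˣ) (n : ℕ) :
    torusChar a (t ^ n) = torusChar ((n : ℤ) • a) t := by
  simp [torusChar_apply, zpow_mul]

theorem torusChar_mem {r : ℕ} (a : Fin r → ℤ) : (fun t => (torusChar a t : ℂ)) ∈ torusRing r := by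
  have h : (fun t : Fin r → ℂˣ => (torusChar a t : ℂ)) =
      ∏ k, fun t => ((t k ^ a k : ℂˣ) : ℂ) := by
    ext t
    simp [torusChar_apply]
  rw [h]
  refine Subalgebra.prod_mem (torusRing r) fun k _ => ?_
  obtain ⟨m, hm | hm⟩ := Int.eq_nat_or_neg (a k)
  · convert Subalgebra.pow_mem (torusRing r) (Algebra.subset_adjoin (Or.inl ⟨k, rfl⟩)) m using 1
    ext t
    simp [hm]
  · convert Subalgebra.pow_mem (torusRing r) (Algebra.subset_adjoin (Or.inr ⟨k, rfl⟩)) m using 1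
    ext t
    simp [hm]

theorem torusRing_le_span (r : ℕ) : Subalgebra.toSubmodule (torusRing r) ≤
    Submodule.span ℂ (Set.range fun (a : Fin r → ℤ) t => (torusChar a t : ℂ)) := by
  rw [torusRing, Algebra.adjoin_eq_span, Submodule.span_le]
  intro m hm
  apply Submodule.subset_span
  induction hm using Submonoid.closure_induction with
  | mem x hx =>
    obtain ⟨k, rfl⟩ | ⟨k, rfl⟩ := hx
    · exact ⟨Pi.single k 1, by simp only [torusChar_single]⟩
    · exact ⟨-Pi.single k 1, by simp only [torusChar_neg, torusChar_single]⟩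
  | one => exact ⟨0, by ext; simp⟩
  | mul x y _ _ hx hy =>
    obtain ⟨a, rfl⟩ := hx
    obtain ⟨b, rfl⟩ := hy
    exact ⟨a + b, by ext; simp [torusChar_add]⟩

/-- The characters of the torus as regular functions. -/
def regChar {r : ℕ} (a : Fin r → ℤ) : Reg (torusRing r) := ⟨_, torusChar_mem a⟩

@[simp] theorem toFun_regChar {r : ℕ} (a : Fin r → ℤ) (t : Fin r → ℂˣ) :
    Reg.toFun (torusRing r) (regChar a) t = torusChar a t := rfl

/-- An element of `Z_n^r` as an element of the torus. -/
def rootsToTorus {r n : ℕ} : (Fin r → Zn n) →* (Fin r → ℂˣ) where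
  toFun ζ k := ζ k
  map_one' := rfl
  map_mul' _ _ := rfl

@[simp] theorem rootsToTorus_apply {r n : ℕ} (ζ : Fin r → Zn n) (k : Fin r) :
    rootsToTorus ζ k = ζ k := rfl

/-- The group `Z_n^r` detects exponents modulo `n`, one coordinate at a time. -/
theorem dvd_of_torusChar_eq_one {r n : ℕ} [NeZero n] {a : Fin r → ℤ}
    (h : ∀ ζ : Fin r → Zn n, torusChar a (rootsToTorus ζ) = 1) (k : Fin r) : (n : ℤ) ∣ a k := by
  have hp := Complex.isPrimitiveRoot_exp n (NeZero.ne n)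
  have hmem : (hp.isUnit (NeZero.ne n)).unit ∈ rootsOfUnity n ℂ := by
    rw [mem_rootsOfUnity']
    exact hp.pow_eq_one
  -- The test element has a primitive `n`-th root of unity in place `k` and `1` elsewhere.
  have := h (Pi.mulSingle k ⟨_, hmem⟩)
  rw [torusChar_apply, Finset.prod_eq_single k] at this
  · rw [← hp.zpow_eq_one_iff_dvd]
    simpa [Units.ext_iff] using this
  · intro b _ hb
    simp [hb]
  · simp

instance (n : ℕ) [NeZero n] : Fintype (Zn n) := Fintype.ofFinite _

/-- Translation by `ζ₀` permutes the summands and multiplies the sum by a number different from `1`.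
-/
theorem sum_torusChar_eq_zero {r n : ℕ} [NeZero n] {a : Fin r → ℤ}
    {ζ₀ : Fin r → Zn n} (h : torusChar a (rootsToTorus ζ₀) ≠ 1) :
    ∑ ζ : Fin r → Zn n, (torusChar a (rootsToTorus ζ) : ℂ) = 0 := by
  have : (torusChar a (rootsToTorus ζ₀) : ℂ) * ∑ ζ : Fin r → Zn n, (torusChar a (rootsToTorus ζ) : ℂ)
      = ∑ ζ : Fin r → Zn n, (torusChar a (rootsToTorus ζ) : ℂ) := by
    rw [Finset.mul_sum]
    refine Fintype.sum_equiv (Equiv.mulLeft ζ₀) _ _ fun ζ => ?_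
    simp
  have h' : (torusChar a (rootsToTorus ζ₀) : ℂ) - 1 ≠ 0 := by
    rwa [sub_ne_zero, Ne, Units.val_eq_one]
  refine (mul_eq_zero.1 ?_).resolve_left h'
  rw [sub_mul, this]
  ring

/-- The exponents `0 ≤ a_k < n`. -/
def finExp {r n : ℕ} (a : Fin r → Fin n) : Fin r → ℤ := fun k => (a k : ℕ)

/-- The dual orthogonality relation: the sum factors into geometric sums over the coordinates, and
one of them vanishes as soon as some `ζ k ≠ 1`. -/
theorem sum_finExp {r n : ℕ} [NeZero n] (ζ : Fin r → Zn n) :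
    ∑ a : Fin r → Fin n, (torusChar (finExp a) (rootsToTorus ζ) : ℂ) =
      if ζ = 1 then (n : ℂ) ^ r else 0 := by
  have h : ∑ a : Fin r → Fin n, (torusChar (finExp a) (rootsToTorus ζ) : ℂ) =
      ∏ k, ∑ j ∈ Finset.range n, ((ζ k : ℂˣ) : ℂ) ^ j := by
    simp_rw [Finset.sum_range]
    rw [Finset.prod_univ_sum]
    simp [torusChar_apply, finExp, Fintype.piFinset_univ]
  rw [h]
  split_ifs with h1
  · simp [h1]
  · obtain ⟨k, hk⟩ := Function.ne_iff.1 h1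
    refine Finset.prod_eq_zero (Finset.mem_univ k) ?_
    have h2 : ((ζ k : ℂˣ) : ℂ) ≠ 1 := fun h =>
      hk (Subtype.ext (Units.ext h))
    have h3 : ((ζ k : ℂˣ) : ℂ) ^ n = 1 := (mem_rootsOfUnity' n _).1 (ζ k).2
    rw [geom_sum_eq h2, h3]
    simp

theorem card_roots (r n : ℕ) [NeZero n] : (Fintype.card (Fin r → Zn n) : ℂ) = (n : ℂ) ^ r := by
  rw [Fintype.card_fun, ← Nat.card_eq_fintype_card, Complex.card_rootsOfUnity]
  simp

/-! ### The scaling map `(ρ, t) ↦ t ρ` -/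

section Scaling

variable {r n : ℕ}

/-- The map `(ρ, t) ↦ t ρ`. -/
def scalePt (p : RepVar r (SLn n) × (Fin r → ℂˣ)) : RepVar r (GLn n) := scaleGL p.2 p.1

/-- The action of `Z_n^r` on `Hom(F_r, SL_n) × (ℂ*)^r`. -/
def actPt (ζ : Fin r → Zn n) (p : RepVar r (SLn n) × (Fin r → ℂˣ)) :
    RepVar r (SLn n) × (Fin r → ℂˣ) :=
  (twistSL ζ p.1, (rootsToTorus ζ)⁻¹ * p.2)

theorem scaleGL_gen_val (t : Fin r → ℂˣ) (ρ : RepVar r (SLn n)) (k : Fin r) :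
    ((scaleGL t ρ).gen k : Matrix (Fin n) (Fin n) ℂ) = (t k : ℂ) • (ρ.gen k).1 := by
  rw [scaleGL, RepVar.gen_ofTuple]
  change Matrix.scalar (Fin n) (t k : ℂ) * (ρ.gen k).1 = _
  simp [Matrix.smul_eq_diagonal_mul]

theorem scaleGL_gen_inv_val (t : Fin r → ℂˣ) (ρ : RepVar r (SLn n)) (k : Fin r) :
    (((scaleGL t ρ).gen k)⁻¹ : GLn n).val = ((t k)⁻¹ : ℂˣ).val • ((ρ.gen k)⁻¹).1 := by
  rw [scaleGL, RepVar.gen_ofTuple, mul_inv_rev, ← map_inv, ← map_inv]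
  change ((ρ.gen k)⁻¹).1 * Matrix.scalar (Fin n) (((t k)⁻¹ : ℂˣ) : ℂ) = _
  ext i j
  simp [mul_comm]

theorem twistSL_gen_val (ζ : Fin r → Zn n) (ρ : RepVar r (SLn n)) (k : Fin r) :
    ((twistSL ζ ρ).gen k).1 = ((ζ k : ℂˣ) : ℂ) • (ρ.gen k).1 := by
  rw [twistSL, RepVar.gen_ofTuple]
  change Matrix.scalar (Fin n) ((ζ k : ℂˣ) : ℂ) * (ρ.gen k).1 = _
  simp [Matrix.smul_eq_diagonal_mul]

theorem twistSL_gen_inv_val (ζ : Fin r → Zn n) (ρ : RepVar r (SLn n)) (k : Fin r) :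
    (((twistSL ζ ρ).gen k)⁻¹).1 = (((ζ k : ℂˣ)⁻¹ : ℂˣ) : ℂ) • ((ρ.gen k)⁻¹).1 := by
  rw [twistSL, RepVar.gen_ofTuple, mul_inv_rev, ← map_inv]
  change ((ρ.gen k)⁻¹).1 * Matrix.scalar (Fin n) (((ζ k)⁻¹ : Zn n) : ℂˣ).val = _
  ext i j
  simp [mul_comm]

@[simp] theorem scalePt_actPt (ζ : Fin r → Zn n) (p : RepVar r (SLn n) × (Fin r → ℂˣ)) :
    scalePt (actPt ζ p) = scalePt p := by
  refine RepVar.ext_gen fun k => Units.ext ?_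
  rw [scalePt, scalePt, scaleGL_gen_val, scaleGL_gen_val, actPt, twistSL_gen_val, smul_smul]
  congr 1
  simp [mul_right_comm]

theorem detRep_scalePt (p : RepVar r (SLn n) × (Fin r → ℂˣ)) :
    detRep (scalePt p) = p.2 ^ n := by
  funext k
  refine Units.ext ?_
  rw [detRep, Matrix.GeneralLinearGroup.val_det_apply, scalePt, scaleGL_gen_val, Matrix.det_smul]
  simp

theorem scalePt_smul (g : SLn n) (ρ : RepVar r (SLn n)) (t : Fin r → ℂˣ) :
    scalePt (g • ρ, t) = stdSL n g • scalePt (ρ, t) := by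
  refine RepVar.ext_gen fun k => Units.ext ?_
  rw [scalePt, scaleGL_gen_val, RepVar.gen_smul, RepVar.gen_smul]
  change (t k : ℂ) • (g.1 * (ρ.gen k).1 * (g⁻¹).1) =
    g.1 * ((scaleGL t ρ).gen k).val * ((g⁻¹).1)
  rw [scaleGL_gen_val]
  simp

theorem exists_scalar_mul_SL [NeZero n] (g : GLn n) :
    ∃ (c : ℂˣ) (h : SLn n), (g : Matrix (Fin n) (Fin n) ℂ) = (c : ℂ) • h.1 := by
  obtain ⟨z, hz⟩ := IsAlgClosed.exists_pow_nat_eq (g : Matrix (Fin n) (Fin n) ℂ).det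
    (Nat.pos_of_ne_zero (NeZero.ne n))
  have hdet : (g : Matrix (Fin n) (Fin n) ℂ).det ≠ 0 := by
    rw [← Matrix.GeneralLinearGroup.val_det_apply]
    exact Units.ne_zero _
  have hz0 : z ≠ 0 := by
    rintro rfl
    exact hdet (by rw [← hz, zero_pow (NeZero.ne n)])
  refine ⟨Units.mk0 z hz0, ⟨z⁻¹ • g.val, ?_⟩, ?_⟩
  · rw [Matrix.det_smul, Fintype.card_fin, ← hz, inv_pow, inv_mul_cancel₀ (pow_ne_zero _ hz0)]
  · simp [smul_smul, hz0]

theorem scalePt_surjective [NeZero n] :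
    Function.Surjective (scalePt : RepVar r (SLn n) × (Fin r → ℂˣ) → RepVar r (GLn n)) := by
  intro σ
  choose c h hc using fun k => exists_scalar_mul_SL (σ.gen k)
  refine ⟨(RepVar.ofTuple h, c), RepVar.ext_gen fun k => Units.ext ?_⟩
  rw [scalePt, scaleGL_gen_val, hc, RepVar.gen_ofTuple]

/-- Up to a scalar, which conjugates trivially, an invertible matrix has determinant one. Hence
invariance under `SL_n` already gives invariance under `GL_n`. -/
theorem exists_SL_smul_eq [NeZero n] (g : GLn n) : ∃ h : SLn n, ∀ σ : RepVar r (GLn n),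
    g • σ = stdSL n h • σ := by
  obtain ⟨c, h, hg⟩ := exists_scalar_mul_SL g
  have : g = Matrix.GeneralLinearGroup.scalar (Fin n) c * stdSL n h := by
    refine Units.ext ?_
    rw [hg]
    change _ = Matrix.scalar (Fin n) (c : ℂ) * h.1
    simp [Matrix.smul_eq_diagonal_mul]
  refine ⟨h, fun σ => ?_⟩
  rw [this, mul_smul]
  refine RepVar.ext_gen fun k => ?_
  rw [RepVar.gen_smul, mul_inv_eq_iff_eq_mul]
  refine Units.ext ?_
  exact (Matrix.scalar_commute (c : ℂ) (fun _ => Commute.all _ _) _).eq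

/-! ### Averaging over `Z_n^r` -/

/-- The average of a function over the action of `Z_n^r`. -/
def avg [NeZero n] (h : RepVar r (SLn n) × (Fin r → ℂˣ) → ℂ)
    (p : RepVar r (SLn n) × (Fin r → ℂˣ)) : ℂ :=
  ((n : ℂ) ^ r)⁻¹ * ∑ ζ : Fin r → Zn n, h (actPt ζ p)

theorem natCast_pow_ne_zero [NeZero n] : (n : ℂ) ^ r ≠ 0 :=
  pow_ne_zero _ (Nat.cast_ne_zero.2 (NeZero.ne n))

theorem avg_eq_self [NeZero n] {h : RepVar r (SLn n) × (Fin r → ℂˣ) → ℂ}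
    (hh : ∀ ζ p, h (actPt ζ p) = h p) : avg h = h := by
  funext p
  simp only [avg, hh, Finset.sum_const, Finset.card_univ, nsmul_eq_mul, card_roots]
  rw [inv_mul_cancel_left₀ natCast_pow_ne_zero]

theorem torusChar_detRep_mem (a : Fin r → ℤ) :
    (fun σ : RepVar r (GLn n) => (torusChar a (detRep σ) : ℂ)) ∈ repRing r (stdGL n) :=
  (comp_detRep_mem r n _ (torusChar_mem a)).1

/-- The generators of the coordinate ring of `Hom(F_r, SL_n) × (ℂ*)^r`: the entries of the matrices
of the generators and of their inverses, the coordinates of the torus and their inverses. -/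
def prodGens (r n : ℕ) : Set (RepVar r (SLn n) × (Fin r → ℂˣ) → ℂ) :=
  {f | ∃ k i j, f = fun p => (p.1.gen k).1 i j} ∪
    {f | ∃ k i j, f = fun p => ((p.1.gen k)⁻¹).1 i j} ∪
    ({f | ∃ k, f = fun p => (p.2 k : ℂ)} ∪ {f | ∃ k, f = fun p => (((p.2 k)⁻¹ : ℂˣ) : ℂ)})

theorem tensorFun_mem_adjoin (z : Reg (repRing r (stdSL n)) ⊗[ℂ] Reg (torusRing r)) :
    tensorFun _ _ z ∈ Algebra.adjoin ℂ (prodGens r n) := by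
  have : (tensorFun (repRing r (stdSL n)) (torusRing r)).range ≤
      Algebra.adjoin ℂ (prodGens r n) := by
    rw [tensorFun, Algebra.TensorProduct.productMap_range, sup_le_iff]
    constructor
    · rintro _ ⟨f, rfl⟩
      refine comp_mem_of_adjoin (R := Algebra.adjoin ℂ (prodGens r n)) Prod.fst ?_ _ f.2
      rintro _ (⟨k, i, j, rfl⟩ | ⟨k, i, j, rfl⟩)
      · exact Algebra.subset_adjoin (Or.inl (Or.inl ⟨k, i, j, rfl⟩))
      · exact Algebra.subset_adjoin (Or.inl (Or.inr ⟨k, i, j, rfl⟩))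
    · rintro _ ⟨f, rfl⟩
      refine comp_mem_of_adjoin (R := Algebra.adjoin ℂ (prodGens r n)) Prod.snd ?_ _ f.2
      rintro _ (⟨k, rfl⟩ | ⟨k, rfl⟩)
      · exact Algebra.subset_adjoin (Or.inr (Or.inl ⟨k, rfl⟩))
      · exact Algebra.subset_adjoin (Or.inr (Or.inr ⟨k, rfl⟩))
  exact this ⟨z, rfl⟩

/-- A monomial is an eigenfunction for `Z_n^r`, and becomes a regular function of `t ρ` after
multiplication by the corresponding character of the torus. -/
theorem exists_weight_of_mem_closure {m : RepVar r (SLn n) × (Fin r → ℂˣ) → ℂ}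
    (hm : m ∈ Submonoid.closure (prodGens r n)) :
    ∃ a : Fin r → ℤ, (∀ (ζ : Fin r → Zn n) p,
        m (actPt ζ p) = torusChar a (rootsToTorus ζ) * m p) ∧
      ∃ F ∈ repRing r (stdGL n), ∀ p, m p * torusChar a p.2 = F (scalePt p) := by
  induction hm using Submonoid.closure_induction with
  | mem x hx =>
    obtain (⟨k, i, j, rfl⟩ | ⟨k, i, j, rfl⟩) | (⟨k, rfl⟩ | ⟨k, rfl⟩) := hx
    · refine ⟨Pi.single k 1, fun ζ p => ?_, _, Algebra.subset_adjoin (Or.inl ⟨k, i, j, rfl⟩),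
        fun p => ?_⟩
      · simp [actPt, twistSL_gen_val, torusChar_single]
      · simp [scalePt, scaleGL_gen_val, torusChar_single, mul_comm]
    · refine ⟨-Pi.single k 1, fun ζ p => ?_, _, Algebra.subset_adjoin (Or.inr ⟨k, i, j, rfl⟩),
        fun p => ?_⟩
      · rw [torusChar_neg, torusChar_single]
        change (((twistSL ζ p.1).gen k)⁻¹).1 i j = _
        rw [twistSL_gen_inv_val]
        rfl
      · rw [torusChar_neg, torusChar_single]
        change _ = ((((scalePt p).gen k)⁻¹ : GLn n).val) i j
        rw [scalePt, scaleGL_gen_inv_val, mul_comm]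
        rfl
    -- The coordinate `t k` has weight `-1`, because `ζ` acts on the torus through `ζ⁻¹`; multiplied
    -- by its character it becomes the constant `1`.
    · refine ⟨-Pi.single k 1, fun ζ p => ?_, 1, one_mem _, fun p => ?_⟩
      · simp [actPt, torusChar_single, torusChar_neg]
      · simp [torusChar_single, torusChar_neg]
    · refine ⟨Pi.single k 1, fun ζ p => ?_, 1, one_mem _, fun p => ?_⟩
      · simp [actPt, torusChar_single, mul_comm]
      · simp [torusChar_single]
  | one => exact ⟨0, by simp, 1, one_mem _, by simp⟩
  | mul x y _ _ hx hy =>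
    obtain ⟨a, ha, F, hF, hFa⟩ := hx
    obtain ⟨b, hb, G, hG, hGb⟩ := hy
    refine ⟨a + b, fun ζ p => ?_, F * G, mul_mem hF hG, fun p => ?_⟩
    · simp only [Pi.mul_apply, ha, hb, torusChar_add, Units.val_mul]
      ring
    · simp only [Pi.mul_apply, ← hFa, ← hGb, torusChar_add, Units.val_mul]
      ring

/-- By linearity only monomials matter, and these are eigenfunctions of `Z_n^r`. A nontrivial weight
averages to zero; a trivial one leaves the monomial fixed, and its torus factor is then a character
of the determinant. -/
theorem exists_avg_eq [NeZero n] {h : RepVar r (SLn n) × (Fin r → ℂˣ) → ℂ}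
    (hh : h ∈ Algebra.adjoin ℂ (prodGens r n)) :
    ∃ F ∈ repRing r (stdGL n), ∀ p, avg h p = F (scalePt p) := by
  rw [← Subalgebra.mem_toSubmodule, Algebra.adjoin_eq_span] at hh
  induction hh using Submodule.span_induction with
  | mem m hm =>
    obtain ⟨a, ha, F, hF, hFa⟩ := exists_weight_of_mem_closure hm
    by_cases h1 : ∀ ζ : Fin r → Zn n, torusChar a (rootsToTorus ζ) = 1
    -- With `a = n e`, the factor `t^(-a)` still separating the monomial from a function of `t ρ`
    -- equals the character of exponent `-e` at `det (t ρ) = t^n`.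
    · choose e he using dvd_of_torusChar_eq_one h1
      refine ⟨_, mul_mem hF (torusChar_detRep_mem (n := n) (-e)), fun p => ?_⟩
      rw [avg_eq_self fun ζ p => by simp [ha, h1], Pi.mul_apply, ← hFa, detRep_scalePt,
        torusChar_pow]
      have : (n : ℤ) • (-e) = -a := by
        funext k
        simp [he k]
      rw [this, torusChar_neg, Units.mul_inv_cancel_right]
    · push Not at h1
      obtain ⟨ζ₀, h0⟩ := h1
      refine ⟨0, zero_mem _, fun p => ?_⟩
      simp only [avg, ha]
      rw [← Finset.sum_mul, sum_torusChar_eq_zero h0]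
      simp
  | zero => exact ⟨0, zero_mem _, fun p => by simp [avg]⟩
  | add f g _ _ hf hg =>
    obtain ⟨F, hF, hFa⟩ := hf
    obtain ⟨G, hG, hGb⟩ := hg
    refine ⟨F + G, add_mem hF hG, fun p => ?_⟩
    simp only [Pi.add_apply, ← hFa, ← hGb, avg, Finset.sum_add_distrib]
    ring
  | smul c f _ hf =>
    obtain ⟨F, hF, hFa⟩ := hf
    refine ⟨c • F, Subalgebra.smul_mem _ hF c, fun p => ?_⟩
    simp only [Pi.smul_apply, ← hFa, avg, smul_eq_mul, ← Finset.mul_sum]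
    ring

/-! ### The coordinate ring of the twisted product -/

/-- The regular functions on `X_r(SL_n) × (ℂ*)^r` as functions on `Hom(F_r, SL_n) × (ℂ*)^r`. -/
def prodFun (r n : ℕ) : prodRing r n →ₐ[ℂ] (RepVar r (SLn n) × (Fin r → ℂˣ) → ℂ) :=
  tensorFun _ _

theorem prodFun_injective : Function.Injective (prodFun r n) := tensorFun_injective _ _

theorem prodFun_actProd (ζ : Fin r → Zn n) (z : prodRing r n) (p) :
    prodFun r n (actProd ζ z) p = prodFun r n z (actPt ζ p) := by
  have : (prodFun r n).comp (actProd ζ) = (pull (actPt ζ)).comp (prodFun r n) := by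
    refine Algebra.TensorProduct.ext' fun f g => ?_
    rfl
  exact congrFun (AlgHom.congr_fun this z) p

theorem mem_twistedRing_iff {z : prodRing r n} :
    z ∈ twistedRing r n ↔ ∀ ζ p, prodFun r n z (actPt ζ p) = prodFun r n z p := by
  simp only [twistedRing, Algebra.mem_iInf, AlgHom.mem_equalizer, ← prodFun_actProd]
  refine forall_congr' fun ζ => ?_
  rw [← prodFun_injective.eq_iff, funext_iff]
  rfl

theorem prodFun_smul (g : SLn n) (ρ : RepVar r (SLn n)) (t : Fin r → ℂˣ) (z : prodRing r n) :
    prodFun r n z (g • ρ, t) = prodFun r n z (ρ, t) := by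
  have : (pull fun p : RepVar r (SLn n) × (Fin r → ℂˣ) => (g • p.1, p.2)).comp (prodFun r n) =
      prodFun r n := by
    refine Algebra.TensorProduct.ext' fun f s => ?_
    funext p
    change f.1 (g • p.1) * s.1 p.2 = f.1 p.1 * s.1 p.2
    rw [f.2.2]
  exact congrFun (AlgHom.congr_fun this z) (ρ, t)

/-- Forgetting the `SL_n`-invariance of the first factor makes generators available, and with them
the decomposition into monomials. -/
theorem prodFun_mem_adjoin (z : prodRing r n) :
    prodFun r n z ∈ Algebra.adjoin ℂ (prodGens r n) := by
  have := tensorFun_mem_range_of_slices (R' := repRing r (stdSL n)) z fun t =>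
    (tensorFun_slice_mem z t).1
  obtain ⟨w, hw⟩ := this
  change tensorFun _ _ z ∈ _
  rw [← hw]
  exact tensorFun_mem_adjoin w

theorem comp_scalePt_mem_range {f : RepVar r (GLn n) → ℂ} (hf : f ∈ repRing r (stdGL n)) :
    f ∘ scalePt ∈ (tensorFun (repRing r (stdSL n)) (torusRing r)).range := by
  refine comp_mem_of_adjoin (R := (tensorFun (repRing r (stdSL n)) (torusRing r)).range)
    scalePt ?_ f hf
  rintro _ (⟨k, i, j, rfl⟩ | ⟨k, i, j, rfl⟩)
  · refine ⟨(show Reg (repRing r (stdSL n)) from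
        ⟨_, Algebra.subset_adjoin (Or.inl ⟨k, i, j, rfl⟩)⟩) ⊗ₜ
        (show Reg (torusRing r) from ⟨_, Algebra.subset_adjoin (Or.inl ⟨k, rfl⟩)⟩), ?_⟩
    funext p
    change (p.1.gen k).1 i j * (p.2 k : ℂ) = ((scalePt p).gen k).val i j
    rw [scalePt, scaleGL_gen_val, mul_comm]
    rfl
  · refine ⟨(show Reg (repRing r (stdSL n)) from
        ⟨_, Algebra.subset_adjoin (Or.inr ⟨k, i, j, rfl⟩)⟩) ⊗ₜ
        (show Reg (torusRing r) from ⟨_, Algebra.subset_adjoin (Or.inr ⟨k, rfl⟩)⟩), ?_⟩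
    funext p
    change ((p.1.gen k)⁻¹).1 i j * (((p.2 k)⁻¹ : ℂˣ) : ℂ) =
      (((scalePt p).gen k)⁻¹ : GLn n).val i j
    rw [scalePt, scaleGL_gen_inv_val, mul_comm]
    rfl

/-- Pulling back entries gives a tensor of possibly non-invariant functions. Its slices at fixed `t`
are invariant, since scaling is equivariant, so the tensor can be rewritten with invariant
coefficients. -/
theorem exists_prodFun_eq {f : RepVar r (GLn n) → ℂ} (hf : f ∈ charRing r (stdGL n)) :
    ∃ z : prodRing r n, prodFun r n z = f ∘ scalePt := by
  obtain ⟨w, hw⟩ := comp_scalePt_mem_range hf.1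
  have := tensorFun_mem_range_of_slices (R' := charRing r (stdSL n)) w fun t => ?_
  · obtain ⟨z, hz⟩ := this
    exact ⟨z, hz.trans hw⟩
  · change tensorFun _ _ w = _ at hw
    refine ⟨?_, fun g ρ => ?_⟩
    · exact tensorFun_slice_mem w t
    · rw [hw]
      simp only [Function.comp_apply, scalePt_smul, hf.2]

end Scaling

/-! ### Pushouts of rings and Cartesian squares of affine schemes -/

/-- Spanning of `S` by the `u k` writes every element of `A ⊗[R] S` as `∑ c k ⊗ u k`; since the
images of the `u k` are an `A`-basis of `P`, the multiplication map to `P` is bijective.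
Independence of the `u k` over `R` is not needed. -/
theorem isPushout_of_basis {R S A P : Type} [CommRing R] [CommRing S] [CommRing A] [CommRing P]
    (f : R →+* A) (g : R →+* S) (i : A →+* P) (j : S →+* P) (h : i.comp f = j.comp g)
    {κ : Type} [Fintype κ] (u : κ → S) (hS : ∀ s, ∃ c : κ → R, s = ∑ k, g (c k) * u k)
    (hP : ∀ p, ∃ c : κ → A, p = ∑ k, i (c k) * j (u k))
    (hinj : ∀ c : κ → A, ∑ k, i (c k) * j (u k) = 0 → c = 0) :
    IsPushout (CommRingCat.ofHom f) (CommRingCat.ofHom g) (CommRingCat.ofHom i)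
      (CommRingCat.ofHom j) := by
  let _ : Algebra R A := f.toAlgebra
  let _ : Algebra R S := g.toAlgebra
  let _ : Algebra R P := (i.comp f).toAlgebra
  let i' : A →ₐ[R] P := { i with commutes' := fun _ => rfl }
  let j' : S →ₐ[R] P := { j with commutes' := fun x => (RingHom.congr_fun h x).symm }
  let μ : A ⊗[R] S →ₐ[R] P := Algebra.TensorProduct.productMap i' j'
  have hspan : ∀ z : A ⊗[R] S, ∃ c : κ → A, z = ∑ k, c k ⊗ₜ u k := by
    intro z
    induction z using TensorProduct.induction_on with
    | zero => exact ⟨0, by simp⟩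
    | tmul a s =>
      obtain ⟨c, rfl⟩ := hS s
      refine ⟨fun k => f (c k) * a, ?_⟩
      rw [TensorProduct.tmul_sum]
      refine Finset.sum_congr rfl fun k _ => ?_
      exact (TensorProduct.tmul_smul (c k) a (u k)).trans (TensorProduct.smul_tmul' (c k) a (u k))
    | add x y hx hy =>
      obtain ⟨c, rfl⟩ := hx
      obtain ⟨d, rfl⟩ := hy
      exact ⟨c + d, by simp [TensorProduct.add_tmul, Finset.sum_add_distrib]⟩
  have hμ : ∀ c : κ → A, μ (∑ k, c k ⊗ₜ u k) = ∑ k, i (c k) * j (u k) := fun c => by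
    rw [map_sum]
    rfl
  have hbij : Function.Bijective μ := by
    constructor
    · rw [injective_iff_map_eq_zero]
      intro z hz
      obtain ⟨c, rfl⟩ := hspan z
      rw [hμ] at hz
      simp [hinj c hz]
    · intro p
      obtain ⟨c, rfl⟩ := hP p
      exact ⟨_, hμ c⟩
  refine (CommRingCat.isPushout_tensorProduct R A S).of_iso (Iso.refl _) (Iso.refl _) (Iso.refl _)
    (RingEquiv.ofBijective μ hbij).toCommRingCatIso (by rfl) (by rfl) ?_ ?_
  · ext a
    change i a * j 1 = i a
    simp
  · ext s
    change i 1 * j s = j s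
    simp

theorem affineMap_comp {A B C : Type} [CommRing A] [Algebra ℂ A] [CommRing B] [Algebra ℂ B]
    [CommRing C] [Algebra ℂ C] (φ : A →ₐ[ℂ] B) (ψ : B →ₐ[ℂ] C) :
    affineMap ψ ≫ affineMap φ = affineMap (ψ.comp φ) := by
  ext : 1
  change Spec.map _ ≫ Spec.map _ = Spec.map _
  rw [← Spec.map_comp, ← CommRingCat.ofHom_comp]
  rfl

theorem affineMap_id {A : Type} [CommRing A] [Algebra ℂ A] :
    affineMap (AlgHom.id ℂ A) = 𝟙 (affine A) := by
  ext : 1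
  exact Spec.map_id (CommRingCat.of A)

/-- The isomorphism of affine varieties given by an isomorphism of coordinate rings. -/
def affineIso {A B : Type} [CommRing A] [Algebra ℂ A] [CommRing B] [Algebra ℂ B] (e : A ≃ₐ[ℂ] B) :
    affine B ≅ affine A where
  hom := affineMap e.toAlgHom
  inv := affineMap e.symm.toAlgHom
  hom_inv_id := by
    rw [affineMap_comp, ← affineMap_id]
    congr 1
    ext x
    simp
  inv_hom_id := by
    rw [affineMap_comp, ← affineMap_id]
    congr 1
    ext x
    simp

/-- `Spec` turns pushouts of rings into pullbacks of schemes, and the forgetful functor from schemes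
over `ℂ` reflects pullbacks. -/
theorem isPullback_affineMap {R S A P : Type} [CommRing R] [CommRing S] [CommRing A] [CommRing P]
    [Algebra ℂ R] [Algebra ℂ S] [Algebra ℂ A] [Algebra ℂ P]
    (f : R →ₐ[ℂ] A) (g : R →ₐ[ℂ] S) (i : A →ₐ[ℂ] P) (j : S →ₐ[ℂ] P)
    (h : IsPushout (CommRingCat.ofHom f.toRingHom) (CommRingCat.ofHom g.toRingHom)
      (CommRingCat.ofHom i.toRingHom) (CommRingCat.ofHom j.toRingHom)) :
    IsPullback (affineMap i) (affineMap j) (affineMap f) (affineMap g) := by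
  refine IsPullback.of_map (Over.forget _) ?_ (isPullback_SpecMap_of_isPushout _ _ _ _ h)
  ext : 1
  change Spec.map _ ≫ Spec.map _ = Spec.map _ ≫ Spec.map _
  rw [← Spec.map_comp, ← Spec.map_comp, h.w]

/-! ### The isomorphism with `X_r(GL_n)` and the Cartesian square -/

section Twisted

variable {r n : ℕ}

theorem prodFun_includeRight (s : Reg (torusRing r)) (p : RepVar r (SLn n) × (Fin r → ℂˣ)) :
    prodFun r n (Algebra.TensorProduct.includeRight s) p = Reg.toFun (torusRing r) s p.2 :=
  (tensorFun_tmul _ _ _ _ _).trans (by simp)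

/-- The pull-back of invariant functions on `Hom(F_r, GL_n)` along the scaling map. -/
def charFun (r n : ℕ) :
    Reg (charRing r (stdGL n)) →ₐ[ℂ] (RepVar r (SLn n) × (Fin r → ℂˣ) → ℂ) :=
  (pull scalePt).comp (Reg.toFun _)

theorem charFun_injective [NeZero n] : Function.Injective (charFun r n) := fun f g h =>
  Reg.ext fun σ => by
    obtain ⟨p, rfl⟩ := scalePt_surjective σ
    exact congrFun h p

/-- The twist commutes with conjugation, so the average is `SL_n`-invariant and the function it
comes from is invariant under `GL_n`. Exponent `0` serves the isomorphism of rings; the exponents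
`-finExp a` extract the components of `z` of the various weights. -/
theorem exists_charFun_eq_avg [NeZero n] (z : prodRing r n) (f : Fin r → ℤ) :
    ∃ F : Reg (charRing r (stdGL n)),
      charFun r n F = avg fun p => torusChar f p.2 * prodFun r n z p := by
  obtain ⟨F, hF, h⟩ := exists_avg_eq (h := fun p => torusChar f p.2 * prodFun r n z p) <| by
    convert prodFun_mem_adjoin (Algebra.TensorProduct.includeRight (regChar f) * z) using 1
    funext p
    rw [map_mul, Pi.mul_apply, prodFun_includeRight, toFun_regChar]
  refine ⟨⟨F, hF, fun g σ => ?_⟩, funext fun p => (h p).symm⟩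
  obtain ⟨⟨ρ, t⟩, rfl⟩ := scalePt_surjective σ
  obtain ⟨g', hg'⟩ := exists_SL_smul_eq (r := r) g
  rw [hg', ← scalePt_smul, ← h, ← h]
  simp only [avg, actPt, twistSL_smul, prodFun_smul]

/-- Functions of `t ρ` are constant on `Z_n^r`-orbits; conversely an invariant function coincides
with its average, which is a function of `t ρ`. -/
theorem charFun_range [NeZero n] :
    (charFun r n).range = ((prodFun r n).comp (twistedRing r n).val).range := by
  apply le_antisymm
  · rintro _ ⟨f, rfl⟩
    obtain ⟨z, hz⟩ := exists_prodFun_eq f.2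
    refine ⟨⟨z, mem_twistedRing_iff.2 fun ζ p => ?_⟩, hz⟩
    rw [hz]
    simp
  · rintro _ ⟨z, rfl⟩
    obtain ⟨F, hF⟩ := exists_charFun_eq_avg z.1 0
    refine ⟨F, hF.trans ?_⟩
    simp only [torusChar_zero, Units.val_one, one_mul]
    exact avg_eq_self (mem_twistedRing_iff.1 z.2)

/-- The isomorphism between the ring of invariants of `GL_n` and the coordinate ring of the twisted
product. -/
def twistedEquiv (r n : ℕ) [NeZero n] : Reg (charRing r (stdGL n)) ≃ₐ[ℂ] twistedRing r n :=
  (AlgEquiv.ofInjective _ charFun_injective).trans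
    ((Subalgebra.equivOfEq _ _ charFun_range).trans
      (AlgEquiv.ofInjective ((prodFun r n).comp (twistedRing r n).val)
        (prodFun_injective.comp Subtype.val_injective)).symm)

theorem prodFun_twistedEquiv [NeZero n] (f : Reg (charRing r (stdGL n))) :
    prodFun r n (twistedEquiv r n f).1 = charFun r n f := by
  have := AlgEquiv.apply_symm_apply (AlgEquiv.ofInjective ((prodFun r n).comp (twistedRing r n).val)
    (prodFun_injective.comp Subtype.val_injective)) (Subalgebra.equivOfEq _ _ charFun_range
      (AlgEquiv.ofInjective _ charFun_injective f))
  exact congrArg Subtype.val this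

theorem ptProd_comp [NeZero n] (ρ : RepVar r (SLn n)) (t : Fin r → ℂˣ) :
    ptProd ρ t ≫ quotGL r n ≫ (affineIso (twistedEquiv r n)).hom = ptGL (scaleGL t ρ) := by
  change affineMap _ ≫ affineMap _ ≫ affineMap _ = affineMap _
  rw [affineMap_comp, affineMap_comp]
  congr 1
  refine AlgHom.ext fun f => ?_
  have h : ∀ z, Algebra.TensorProduct.productMap (evalReg (charRing r (stdSL n)) ρ)
      (evalReg (torusRing r) t) z = prodFun r n z (ρ, t) := by
    have : Algebra.TensorProduct.productMap (evalReg (charRing r (stdSL n)) ρ)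
        (evalReg (torusRing r) t) =
          (Pi.evalAlgHom ℂ (fun _ => ℂ) (ρ, t)).comp (prodFun r n) :=
      Algebra.TensorProduct.ext' fun f g => rfl
    exact fun z => AlgHom.congr_fun this z
  exact (h _).trans (congrFun (prodFun_twistedEquiv f) (ρ, t))

theorem exists_finExp_add [NeZero n] (a : Fin r → ℤ) :
    ∃ (b : Fin r → Fin n) (e : Fin r → ℤ), a = finExp b + (n : ℤ) • e := by
  have hn : (0 : ℤ) < n := by exact_mod_cast Nat.pos_of_ne_zero (NeZero.ne n)
  have h : ∀ k, (a k % n).toNat < n := fun k => by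
    have h1 := Int.emod_nonneg (a k) hn.ne'
    have h2 := Int.emod_lt_of_pos (a k) hn
    omega
  refine ⟨fun k => ⟨_, h k⟩, fun k => a k / n, funext fun k => ?_⟩
  have h1 := Int.emod_nonneg (a k) hn.ne'
  simp only [finExp, Pi.add_apply, Pi.smul_apply, smul_eq_mul, Int.toNat_of_nonneg h1]
  exact (Int.emod_add_mul_ediv (a k) n).symm

/-- Division of exponents by `n` with remainder: `t^(b + n e) = (t^n)^e t^b`. -/
theorem torus_exists_sum [NeZero n] (s : Reg (torusRing r)) :
    ∃ c : (Fin r → Fin n) → Reg (torusRing r),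
      s = ∑ a, pullReg (fun t => t ^ n) (comp_pow_mem r n) (c a) * regChar (finExp a) := by
  obtain ⟨s, hs⟩ := s
  have hs' := torusRing_le_span r hs
  suffices H : ∃ c : (Fin r → Fin n) → Reg (torusRing r), ∀ t,
      s t = ∑ a, Reg.toFun _ (c a) (t ^ n) * torusChar (finExp a) t by
    obtain ⟨c, hc⟩ := H
    refine ⟨c, Reg.ext fun t => ?_⟩
    simp only [map_sum, map_mul, Finset.sum_apply, Pi.mul_apply]
    exact hc t
  clear hs
  induction hs' using Submodule.span_induction with
  | mem m hm =>
    obtain ⟨a, rfl⟩ := hm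
    obtain ⟨b, e, rfl⟩ := exists_finExp_add (n := n) a
    refine ⟨Pi.single b (regChar e), fun t => ?_⟩
    rw [Finset.sum_eq_single b]
    · simp [torusChar_add, torusChar_pow, mul_comm]
    · intro a _ ha
      simp [ha]
    · simp
  | zero => exact ⟨0, by simp⟩
  | add f g _ _ hf hg =>
    obtain ⟨c, hc⟩ := hf
    obtain ⟨d, hd⟩ := hg
    exact ⟨c + d, fun t => by simp [hc, hd, add_mul, Finset.sum_add_distrib]⟩
  | smul x f _ hf =>
    obtain ⟨c, hc⟩ := hf
    exact ⟨x • c, fun t => by simp [hc, Finset.mul_sum, mul_assoc]⟩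

/-- Fourier inversion on `Z_n^r`: the coefficient of `t^a` is the average of `t^(-a) z`. When these
are recombined, the sum over `a` of the characters of `ζ` leaves only `ζ = 1`. -/
theorem prod_exists_sum [NeZero n] (z : prodRing r n) :
    ∃ c : (Fin r → Fin n) → Reg (charRing r (stdGL n)),
      ∀ p, prodFun r n z p = ∑ a, charFun r n (c a) p * torusChar (finExp a) p.2 := by
  choose c hc using fun a : Fin r → Fin n => exists_charFun_eq_avg z (-finExp a)
  refine ⟨c, fun p => ?_⟩
  have h1 : ∀ (a : Fin r → Fin n) (ζ : Fin r → Zn n),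
      (torusChar (-finExp a) (actPt ζ p).2 : ℂ) * prodFun r n z (actPt ζ p) *
        torusChar (finExp a) p.2 =
      torusChar (finExp a) (rootsToTorus ζ) * prodFun r n z (actPt ζ p) := fun a ζ => by
    rw [mul_right_comm, ← Units.val_mul]
    congr 2
    simp [torusChar_neg, actPt]
  have hact : actPt (1 : Fin r → Zn n) p = p := by
    refine Prod.ext (RepVar.ext_gen fun k => ?_) ?_
    · simp [actPt, twistSL]
    · simp [actPt]
  simp only [hc, avg, mul_assoc, Finset.sum_mul, ← Finset.mul_sum]
  rw [Finset.sum_comm]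
  simp only [← mul_assoc, h1, ← Finset.sum_mul, sum_finExp]
  simp only [ite_mul, zero_mul, Finset.sum_ite_eq', Finset.mem_univ, if_true, hact]
  rw [inv_mul_cancel_left₀ natCast_pow_ne_zero]

/-- The relation at `ζ p`, weighted by the character of exponent `b` and summed over `ζ`, keeps only
the term `a = b`: two exponents in `[0, n)` that agree modulo `n` are equal. The coefficient `c b`
is then multiplied by `n^r` and a unit. -/
theorem prod_sum_eq_zero [NeZero n] (c : (Fin r → Fin n) → Reg (charRing r (stdGL n)))
    (h : ∀ p, ∑ a, charFun r n (c a) p * torusChar (finExp a) p.2 = 0) : c = 0 := by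
  funext b
  refine Reg.ext fun σ => ?_
  obtain ⟨p, rfl⟩ := scalePt_surjective σ
  have h1 : ∑ a, charFun r n (c a) p * (torusChar (finExp a) p.2 : ℂ) *
      ∑ ζ : Fin r → Zn n, (torusChar (finExp b - finExp a) (rootsToTorus ζ) : ℂ) = 0 := by
    simp only [Finset.mul_sum]
    rw [Finset.sum_comm]
    refine Finset.sum_eq_zero fun ζ _ => ?_
    have := congrArg (fun x => (torusChar (finExp b) (rootsToTorus ζ) : ℂ) * x) (h (actPt ζ p))
    simp only [mul_zero, Finset.mul_sum] at this
    rw [← this]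
    refine Finset.sum_congr rfl fun a _ => ?_
    have h2 : charFun r n (c a) (actPt ζ p) = charFun r n (c a) p := by
      change Reg.toFun _ (c a) (scalePt _) = Reg.toFun _ (c a) (scalePt _)
      rw [scalePt_actPt]
    rw [h2, sub_eq_add_neg, torusChar_add, torusChar_neg, actPt, map_mul, map_inv]
    push_cast
    ring
  rw [Finset.sum_eq_single b] at h1
  · have h3 : ∑ ζ : Fin r → Zn n, (torusChar (finExp b - finExp b) (rootsToTorus ζ) : ℂ) ≠ 0 := by
      simp only [sub_self, torusChar_zero, Units.val_one, Finset.sum_const, Finset.card_univ,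
        nsmul_eq_mul, card_roots, mul_one]
      exact natCast_pow_ne_zero
    exact (mul_eq_zero.1 ((mul_eq_zero.1 h1).resolve_right h3)).resolve_right (Units.ne_zero _)
  · intro a _ ha
    have : ∃ ζ : Fin r → Zn n, torusChar (finExp b - finExp a) (rootsToTorus ζ) ≠ 1 := by
      by_contra! hall
      refine ha (funext fun k => ?_)
      have h4 := dvd_of_torusChar_eq_one hall k
      have h5 := (a k).2
      have h6 := (b k).2
      simp only [finExp, Pi.sub_apply] at h4
      have h7 := Int.eq_zero_of_abs_lt_dvd h4 (by rw [abs_lt]; constructor <;> omega)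
      exact Fin.ext (by omega)
    obtain ⟨ζ₀, h0⟩ := this
    rw [sum_torusChar_eq_zero h0, mul_zero]
  · simp

theorem isPullback_detGL [NeZero n] :
    IsPullback (quotGL r n ≫ (affineIso (twistedEquiv r n)).hom) (projTorus r n)
      (detGL r n) (powTorus r n) := by
  have hq : quotGL r n ≫ (affineIso (twistedEquiv r n)).hom =
      affineMap ((twistedRing r n).val.comp (twistedEquiv r n).toAlgHom) := affineMap_comp _ _
  rw [hq]
  have hi : ∀ f, prodFun r n ((twistedRing r n).val.comp (twistedEquiv r n).toAlgHom f) =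
      charFun r n f := prodFun_twistedEquiv
  have hsum : ∀ (c : (Fin r → Fin n) → Reg (charRing r (stdGL n))) (p), prodFun r n (∑ a,
      ((twistedRing r n).val.comp (twistedEquiv r n).toAlgHom).toRingHom (c a) *
        (Algebra.TensorProduct.includeRight : _ →ₐ[ℂ] prodRing r n).toRingHom
          (regChar (finExp a))) p =
      ∑ a, charFun r n (c a) p * torusChar (finExp a) p.2 := fun c p => by
    simp only [map_sum, map_mul, Finset.sum_apply, Pi.mul_apply]
    refine Finset.sum_congr rfl fun a _ => ?_
    exact congrArg₂ (· * ·) (congrFun (hi (c a)) p) (prodFun_includeRight _ p)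
  refine isPullback_affineMap _ _ _ _ (isPushout_of_basis _ _ _ _ ?_
    (fun a : Fin r → Fin n => regChar (finExp a)) torus_exists_sum ?_ ?_)
  -- Commutativity of the square is the identity `det (t ρ) = t^n`.
  · refine RingHom.ext fun s => prodFun_injective (funext fun p => ?_)
    refine (congrFun (hi _) p).trans (Eq.trans ?_ (prodFun_includeRight _ p).symm)
    exact congrArg s.1 (detRep_scalePt p)
  · intro z
    obtain ⟨c, hc⟩ := prod_exists_sum z
    exact ⟨c, prodFun_injective (funext fun p => (hc p).trans (hsum c p).symm)⟩
  · intro c hc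
    refine prod_sum_eq_zero c fun p => ?_
    rw [← hsum, hc]
    simp

end Twisted

/-! ### The centres of `SL_n` and `SU(n)` -/

section Centre

variable {n : ℕ}

theorem center_SL (n : ℕ) [NeZero n] : Subgroup.center (SLn n) = (scalarSL n).range := by
  ext A
  rw [Matrix.SpecialLinearGroup.mem_center_iff]
  constructor
  · rintro ⟨z, hz, hA⟩
    rw [Fintype.card_fin] at hz
    exact ⟨rootsOfUnity.mkOfPowEq z hz, Subtype.ext hA⟩
  · rintro ⟨ω, rfl⟩
    exact ⟨_, by simpa using (mem_rootsOfUnity' n _).1 ω.2, rfl⟩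

theorem diagonal_mem_SU {d : Fin n → ℂ} (hd : ∀ i, d i * star (d i) = 1) (h : ∏ i, d i = 1) :
    Matrix.diagonal d ∈ Matrix.specialUnitaryGroup (Fin n) ℂ := by
  rw [Matrix.mem_specialUnitaryGroup_iff, Matrix.mem_unitaryGroup_iff, Matrix.det_diagonal]
  refine ⟨?_, h⟩
  rw [Matrix.star_eq_conjTranspose, Matrix.diagonal_conjTranspose, Matrix.diagonal_mul_diagonal]
  simp only [Pi.star_apply, hd, Matrix.diagonal_one]

/-- The sign in one column corrects the determinant `-1` of the transposition. -/
theorem signedSwap_mem_SU {i j : Fin n} (hij : i ≠ j) :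
    (Equiv.swap i j).permMatrix ℂ * Matrix.diagonal (Function.update 1 i (-1)) ∈
      Matrix.specialUnitaryGroup (Fin n) ℂ := by
  rw [Matrix.mem_specialUnitaryGroup_iff]
  constructor
  · refine mul_mem ?_ ?_
    · rw [Matrix.mem_unitaryGroup_iff, Matrix.star_eq_conjTranspose, Matrix.conjTranspose_permMatrix,
        ← Matrix.permMatrix_mul]
      simp
    · rw [Matrix.mem_unitaryGroup_iff, Matrix.star_eq_conjTranspose,
        Matrix.diagonal_conjTranspose, Matrix.diagonal_mul_diagonal, ← Matrix.diagonal_one]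
      congr 1
      funext k
      by_cases hk : k = i <;> simp [hk]
  · rw [Matrix.det_mul, Matrix.det_permutation, Matrix.det_diagonal, Equiv.Perm.sign_swap hij,
      Finset.prod_update_of_mem (Finset.mem_univ i)]
    simp

/-- Commuting with diagonal matrices kills the off-diagonal entries, and commuting with signed
transpositions makes the diagonal constant; the determinant then makes the scalar an `n`-th root of
unity. -/
theorem center_SU (n : ℕ) [NeZero n] : Subgroup.center (SUn n) = (scalarSU n).range := by
  ext A
  rw [Subgroup.mem_center_iff]
  constructor
  · intro hA
    have hc : ∀ B ∈ Matrix.specialUnitaryGroup (Fin n) ℂ, B * A.1 = A.1 * B := fun B hB =>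
      congrArg Subtype.val (hA ⟨B, hB⟩)
    have hoff : ∀ i j, i ≠ j → A.1 i j = 0 := by
      intro i j hij
      -- The entries `I` and `-I` have product `1` and difference `2 I ≠ 0`.
      have h := congrFun (congrFun (hc _ (diagonal_mem_SU
        (d := Function.update (Function.update 1 i Complex.I) j (-Complex.I)) ?_ ?_)) i) j
      · rw [Matrix.diagonal_mul, Matrix.mul_diagonal] at h
        simp only [Function.update_of_ne hij, Function.update_self] at h
        have h2 : (2 * Complex.I) * A.1 i j = 0 := by linear_combination h
        simpa using h2
      · intro k
        by_cases hk : k = j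
        · simp [hk]
        · by_cases hk' : k = i
          · subst hk'
            simp [hij]
          · simp [hk, hk']
      · rw [Finset.prod_update_of_mem (Finset.mem_univ j), Finset.prod_update_of_mem
          (by simpa using hij)]
        simp
    have hdiag : ∀ i j, A.1 i i = A.1 j j := by
      intro i j
      by_cases hij : i = j
      · rw [hij]
      -- With `B` the signed swap, whose `(i, j)` entry is `1`, the `(i, j)` entries of `B A` and `A
      -- B` are `A j j` and `A i i`.
      · have h := congrFun (congrFun (hc _ (signedSwap_mem_SU hij)) i) j
        rw [Matrix.mul_apply, Matrix.mul_apply, Finset.sum_eq_single j, Finset.sum_eq_single i] at h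
        · simpa [Equiv.Perm.permMatrix, PEquiv.toMatrix_apply, Ne.symm hij] using h.symm
        · intro b _ hb
          rw [hoff _ _ hb.symm, zero_mul]
        · simp
        · intro b _ hb
          rw [hoff _ _ hb, mul_zero]
        · simp
    have hsc : A.1 = Matrix.scalar (Fin n) (A.1 0 0) := by
      ext i j
      by_cases hij : i = j
      · subst hij
        simp [hdiag i 0]
      · simp [hij, hoff i j hij]
    have hdet : (A.1 0 0) ^ n = 1 := by
      have := (Matrix.mem_specialUnitaryGroup_iff.1 A.2).2
      rw [hsc] at this
      simpa using this
    exact ⟨rootsOfUnity.mkOfPowEq _ hdet, Subtype.ext hsc.symm⟩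
  · rintro ⟨ω, rfl⟩ B
    refine Subtype.ext ?_
    exact (Matrix.scalar_commute _ (fun _ => Commute.all _ _) _).eq.symm

end Centre

/-! ### Topology of spaces of representations -/

section Topology

theorem cls_eq_iff {r : ℕ} {G : Type} [Group G] {ρ σ : RepVar r G} :
    cls ρ = cls σ ↔ ρ ∈ MulAction.orbit G σ :=
  Quotient.eq

/-- `Hom(F_r, G)` is homeomorphic to `G ^ r`. -/
def genHomeo (r : ℕ) (G : Type) [Group G] [TopologicalSpace G] : RepVar r G ≃ₜ (Fin r → G) :=
  Equiv.toHomeomorphOfIsInducing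
    { toFun := RepVar.gen
      invFun := RepVar.ofTuple
      left_inv := fun ρ => RepVar.ext_gen fun k => by simp
      right_inv := fun a => by funext k; simp } ⟨rfl⟩

variable {r : ℕ} {G : Type} [Group G] [TopologicalSpace G]

theorem continuous_gen (k : Fin r) : Continuous fun ρ : RepVar r G => ρ.gen k :=
  (continuous_apply k).comp (genHomeo r G).continuous

theorem continuous_repVar_iff {Z : Type} [TopologicalSpace Z] {f : Z → RepVar r G} :
    Continuous f ↔ ∀ k, Continuous fun z => (f z).gen k := by
  rw [← (genHomeo r G).comp_continuous_iff, continuous_pi_iff]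
  rfl

theorem continuousAt_repVar_iff {Z : Type} [TopologicalSpace Z] {f : Z → RepVar r G} {z : Z} :
    ContinuousAt f z ↔ ∀ k, ContinuousAt (fun z => (f z).gen k) z := by
  rw [(genHomeo r G).isInducing.continuousAt_iff, continuousAt_pi]
  rfl

instance [CompactSpace G] : CompactSpace (RepVar r G) := (genHomeo r G).symm.compactSpace

instance [T2Space G] : T2Space (RepVar r G) := (genHomeo r G).symm.t2Space

instance [IsTopologicalGroup G] : ContinuousSMul G (RepVar r G) where
  continuous_smul := by
    rw [continuous_repVar_iff]
    intro k
    have := (continuous_gen (G := G) k).comp (continuous_snd (X := G))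
    exact (continuous_fst.mul this).mul continuous_fst.inv

instance [ContinuousMul G] : ContinuousConstSMul G (RepVar r G) where
  continuous_const_smul g := by
    rw [continuous_repVar_iff]
    intro k
    exact (continuous_const.mul (continuous_gen k)).mul continuous_const

theorem isOpenQuotientMap_cls [ContinuousMul G] :
    IsOpenQuotientMap (cls : RepVar r G → orbitSpace r G) where
  surjective := cls_surjective
  continuous := continuous_quotient_mk'
  isOpenMap := isOpenMap_quotient_mk'_mul

theorem isCompact_unitary (n : ℕ) :
    IsCompact (Matrix.unitaryGroup (Fin n) ℂ : Set (Matrix (Fin n) (Fin n) ℂ)) := by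
  have hb : IsCompact (Set.univ.pi fun _ : Fin n => Set.univ.pi fun _ : Fin n =>
      Metric.closedBall (0 : ℂ) 1) :=
    isCompact_univ_pi fun _ => isCompact_univ_pi fun _ => isCompact_closedBall 0 1
  refine hb.of_isClosed_subset ?_ fun U hU i _ j _ => ?_
  · have : (Matrix.unitaryGroup (Fin n) ℂ : Set (Matrix (Fin n) (Fin n) ℂ)) =
        {A | A * star A = 1} := by
      ext A
      exact Matrix.mem_unitaryGroup_iff
    rw [this]
    exact isClosed_eq (by fun_prop) continuous_const
  · simpa using entry_norm_bound_of_unitary hU i j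

instance (n : ℕ) : CompactSpace (Un n) := isCompact_iff_compactSpace.1 (isCompact_unitary n)

instance (n : ℕ) : CompactSpace (SUn n) := by
  refine isCompact_iff_compactSpace.1 ?_
  have : (Matrix.specialUnitaryGroup (Fin n) ℂ : Set (Matrix (Fin n) (Fin n) ℂ)) =
      (Matrix.unitaryGroup (Fin n) ℂ : Set (Matrix (Fin n) (Fin n) ℂ)) ∩ {A | A.det = 1} := by
    ext A
    exact Matrix.mem_specialUnitaryGroup_iff
  rw [this]
  exact (isCompact_unitary n).inter_right (isClosed_eq continuous_id.matrix_det continuous_const)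

end Topology

/-! ### Polynomial invariants of compact groups separate orbits -/

section Invariants

open MeasureTheory

/-- Each monomial is a product of a function of `g` and a monomial in `x`; integration only changes
the coefficient. -/
theorem exists_eval_eq_integral {G ι κ : Type} [TopologicalSpace G] [CompactSpace G] [Fintype ι]
    [Fintype κ] [MeasurableSpace G] [BorelSpace G] (μ : Measure G)
    [IsFiniteMeasure μ] {cG : G → κ → ℝ} (hcG : Continuous cG) (Q : MvPolynomial (κ ⊕ ι) ℝ) :
    ∃ q : MvPolynomial ι ℝ, ∀ x : ι → ℝ,
      ∫ g, MvPolynomial.eval (Sum.elim (cG g) x) Q ∂μ = MvPolynomial.eval x q := by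
  have hint : ∀ (Q : MvPolynomial (κ ⊕ ι) ℝ) (x : ι → ℝ),
      Integrable (fun g => MvPolynomial.eval (Sum.elim (cG g) x) Q) μ := fun Q x => by
    have hc : Continuous fun g => MvPolynomial.eval (Sum.elim (cG g) x) Q := by
      refine (MvPolynomial.continuous_eval Q).comp (continuous_pi fun i => ?_)
      cases i with
      | inl k => exact (continuous_apply k).comp hcG
      | inr i => exact continuous_const
    exact hc.integrable_of_hasCompactSupport (HasCompactSupport.of_compactSpace _)
  induction Q using MvPolynomial.induction_on' with
  | monomial u a =>
    refine ⟨MvPolynomial.C (∫ g, a * ∏ k, cG g k ^ u (Sum.inl k) ∂μ) *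
      ∏ i, MvPolynomial.X i ^ u (Sum.inr i), fun x => ?_⟩
    simp only [MvPolynomial.eval_monomial, map_mul, MvPolynomial.eval_C, map_prod, map_pow,
      MvPolynomial.eval_X, Finsupp.prod_fintype _ _ fun _ => pow_zero _, Fintype.prod_sum_type,
      Sum.elim_inl, Sum.elim_inr, ← mul_assoc]
    rw [integral_mul_const]
  | add p q hp hq =>
    obtain ⟨p', hp'⟩ := hp
    obtain ⟨q', hq'⟩ := hq
    refine ⟨p' + q', fun x => ?_⟩
    simp only [map_add]
    rw [integral_add (hint p x) (hint q x), hp', hq']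

theorem eval_bind₁ {ι κ : Type} (x : κ → ℝ) (P : ι → MvPolynomial κ ℝ) (p : MvPolynomial ι ℝ) :
    MvPolynomial.eval x (MvPolynomial.bind₁ P p) =
      MvPolynomial.eval (fun i => MvPolynomial.eval x (P i)) p := by
  rw [MvPolynomial.eval, MvPolynomial.eval₂Hom_bind₁]
  rfl

/-- Distinct orbits are disjoint closed sets, so Urysohn's lemma separates them by a continuous
function. Stone-Weierstrass approximates it by a polynomial, and Haar averaging makes that
polynomial invariant without destroying the separation. -/
theorem mem_orbit_of_forall_invariant {G X ι κ : Type} [Group G] [TopologicalSpace G]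
    [IsTopologicalGroup G] [CompactSpace G] [TopologicalSpace X] [CompactSpace X] [T2Space X]
    [MulAction G X] [ContinuousSMul G X] [Fintype ι] [Fintype κ] {cX : X → ι → ℝ} (hcX : Continuous cX)
    (hinj : Function.Injective cX) {cG : G → κ → ℝ} (hcG : Continuous cG)
    (hact : ∀ i, ∃ P : MvPolynomial (κ ⊕ ι) ℝ, ∀ g x,
      cX (g⁻¹ • x) i = MvPolynomial.eval (Sum.elim (cG g) (cX x)) P) {x y : X}
    (h : ∀ P : MvPolynomial ι ℝ,
      (∀ (g : G) z, MvPolynomial.eval (cX (g • z)) P = MvPolynomial.eval (cX z) P) →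
        MvPolynomial.eval (cX x) P = MvPolynomial.eval (cX y) P) :
    x ∈ MulAction.orbit G y := by
  by_contra hxy
  have hclosed : ∀ z : X, IsClosed (MulAction.orbit G z) := fun z =>
    (isCompact_range (continuous_id.smul continuous_const)).isClosed
  have hdisj : Disjoint (MulAction.orbit G x) (MulAction.orbit G y) := by
    refine (MulAction.orbit.eq_or_disjoint x y).resolve_left fun he => hxy ?_
    rw [← he]
    exact MulAction.mem_orbit_self x
  obtain ⟨f, hf0, hf1, -⟩ := exists_continuous_zero_one_of_isClosed (hclosed x) (hclosed y) hdisj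
  let c : ι → C(X, ℝ) := fun i => ⟨fun z => cX z i, (continuous_apply i).comp hcX⟩
  have hc : ∀ (p : MvPolynomial ι ℝ) z, MvPolynomial.aeval c p z = MvPolynomial.eval (cX z) p := by
    intro p z
    have : (ContinuousMap.evalAlgHom ℝ ℝ z).comp (MvPolynomial.aeval c) =
        MvPolynomial.aeval (cX z) := by
      ext i
      simp [c]
    have h2 := AlgHom.congr_fun this p
    exact h2.trans (by rw [← MvPolynomial.coe_aeval_eq_eval]; rfl)
  have hsep : (MvPolynomial.aeval (R := ℝ) c).range.SeparatesPoints := by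
    intro z w hzw
    obtain ⟨i, hi⟩ := Function.ne_iff.1 (hinj.ne hzw)
    exact ⟨c i, ⟨c i, ⟨MvPolynomial.X i, by simp⟩, rfl⟩, hi⟩
  have hdense := ContinuousMap.subalgebra_topologicalClosure_eq_top_of_separatesPoints _ hsep
  have hfmem : f ∈ (MvPolynomial.aeval (R := ℝ) c).range.topologicalClosure := by
    rw [hdense]
    trivial
  -- Any error below `1/2` would do: the averages over the two orbits stay near `0` and near `1`.
  obtain ⟨-, ⟨p, rfl⟩, hp⟩ := Metric.mem_closure_iff.1 hfmem (1 / 3) (by norm_num)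
  have hp' : ∀ z, |f z - MvPolynomial.eval (cX z) p| < 1 / 3 := fun z => by
    rw [← hc]
    exact (ContinuousMap.dist_apply_le_dist z).trans_lt hp
  choose P hP using hact
  let _ : MeasurableSpace G := borel G
  have : BorelSpace G := ⟨rfl⟩
  -- Normalizing on the whole group gives Haar measure total mass one.
  let K : TopologicalSpace.PositiveCompacts G := ⊤
  let μ : Measure G := Measure.haarMeasure K
  have hμ : IsProbabilityMeasure μ := ⟨by
    have := Measure.haarMeasure_self (K₀ := K)
    simpa [K] using this⟩
  obtain ⟨q, hq⟩ := exists_eval_eq_integral μ hcG (MvPolynomial.bind₁ P p)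
  have hev : ∀ g z, MvPolynomial.eval (Sum.elim (cG g) (cX z)) (MvPolynomial.bind₁ P p) =
      MvPolynomial.eval (cX (g⁻¹ • z)) p := fun g z => by
    rw [eval_bind₁, show cX (g⁻¹ • z) = fun i => MvPolynomial.eval (Sum.elim (cG g) (cX z)) (P i)
      from funext fun i => hP i g z]
  have hq' : ∀ z, ∫ g, MvPolynomial.eval (cX (g⁻¹ • z)) p ∂μ = MvPolynomial.eval (cX z) q :=
    fun z => by
      rw [← hq]
      simp only [hev]
  have hxyq := h q fun g z => by
    -- Since the average is taken over `k⁻¹ • z`, replacing `z` by `g • z` is the left translation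
    -- of `k` by `g⁻¹`.
    have := integral_mul_left_eq_self (μ := μ)
      (fun k => MvPolynomial.eval (cX (k⁻¹ • z)) p) g⁻¹
    simp only [mul_inv_rev, inv_inv, mul_smul] at this
    rw [← hq', ← hq', this]
  have hx : ∀ g : G, f (g⁻¹ • x) = 0 := fun g => hf0 (MulAction.mem_orbit x g⁻¹)
  have hy : ∀ g : G, f (g⁻¹ • y) = 1 := fun g => hf1 (MulAction.mem_orbit y g⁻¹)
  have hint : Integrable (fun g : G => MvPolynomial.eval (cX (g⁻¹ • y)) p) μ := by
    have hcont : Continuous fun g : G => MvPolynomial.eval (cX (g⁻¹ • y)) p :=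
      (MvPolynomial.continuous_eval p).comp (hcX.comp (continuous_inv.smul continuous_const))
    exact hcont.integrable_of_hasCompactSupport (HasCompactSupport.of_compactSpace _)
  have h1 : ‖∫ g, MvPolynomial.eval (cX (g⁻¹ • x)) p ∂μ‖ ≤ 1 / 3 := by
    refine (norm_integral_le_of_norm_le_const (C := 1 / 3) (.of_forall fun g => ?_)).trans ?_
    · have := hp' (g⁻¹ • x)
      rw [hx, zero_sub, abs_neg] at this
      exact this.le
    · simp
  have h2 : ‖∫ g, (1 - MvPolynomial.eval (cX (g⁻¹ • y)) p) ∂μ‖ ≤ 1 / 3 := by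
    refine (norm_integral_le_of_norm_le_const (C := 1 / 3) (.of_forall fun g => ?_)).trans ?_
    · have := hp' (g⁻¹ • y)
      rw [hy] at this
      exact this.le
    · simp
  rw [integral_sub (integrable_const _) hint, hq', ← hxyq] at h2
  rw [hq'] at h1
  simp only [integral_const, probReal_univ, smul_eq_mul, mul_one, Real.norm_eq_abs, abs_le] at h1 h2
  linarith

/-- The orbits of a compact group acting polynomially are the fibres of finitely many polynomial
conditions on pairs of points. -/
theorem exists_finset_mem_orbit_iff {G X ι κ : Type} [Group G] [TopologicalSpace G]
    [IsTopologicalGroup G] [CompactSpace G] [TopologicalSpace X] [CompactSpace X] [T2Space X]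
    [MulAction G X] [ContinuousSMul G X] [Fintype ι] [Fintype κ] {cX : X → ι → ℝ}
    (hcX : Continuous cX) (hinj : Function.Injective cX) {cG : G → κ → ℝ} (hcG : Continuous cG)
    (hact : ∀ i, ∃ P : MvPolynomial (κ ⊕ ι) ℝ, ∀ g x,
      cX (g⁻¹ • x) i = MvPolynomial.eval (Sum.elim (cG g) (cX x)) P) :
    ∃ s : Finset (MvPolynomial (ι ⊕ ι) ℝ), ∀ x y, x ∈ MulAction.orbit G y ↔
      ∀ p ∈ s, MvPolynomial.eval (Sum.elim (cX x) (cX y)) p = 0 := by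
  let T : Set (MvPolynomial (ι ⊕ ι) ℝ) := {Q | ∃ P : MvPolynomial ι ℝ,
    (∀ (g : G) z, MvPolynomial.eval (cX (g • z)) P = MvPolynomial.eval (cX z) P) ∧
      Q = MvPolynomial.rename Sum.inl P - MvPolynomial.rename Sum.inr P}
  -- Hilbert's basis theorem replaces the infinitely many equations `P(x) = P(y)` by finitely many.
  obtain ⟨s, hs⟩ := (inferInstance : IsNoetherianRing (MvPolynomial (ι ⊕ ι) ℝ)).noetherian
    (Ideal.span T)
  have hev : ∀ x y (P : MvPolynomial ι ℝ), MvPolynomial.eval (Sum.elim (cX x) (cX y))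
      (MvPolynomial.rename Sum.inl P - MvPolynomial.rename Sum.inr P) =
        MvPolynomial.eval (cX x) P - MvPolynomial.eval (cX y) P := fun x y P => by
    simp [MvPolynomial.eval_rename]
  refine ⟨s, fun x y => ⟨?_, fun h => ?_⟩⟩
  · rintro ⟨g, rfl⟩ p hp
    have hle : Ideal.span T ≤ RingHom.ker (MvPolynomial.eval (Sum.elim (cX (g • y)) (cX y))) := by
      rw [Ideal.span_le]
      rintro _ ⟨P, hP, rfl⟩
      rw [SetLike.mem_coe, RingHom.mem_ker, hev, hP, sub_self]
    exact hle (hs ▸ Submodule.subset_span hp)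
  · refine mem_orbit_of_forall_invariant hcX hinj hcG hact fun P hP => ?_
    have hle : Ideal.span T ≤ RingHom.ker (MvPolynomial.eval (Sum.elim (cX x) (cX y))) := by
      rw [← hs]
      exact Submodule.span_le.2 h
    have := hle (Ideal.subset_span ⟨P, hP, rfl⟩)
    rwa [RingHom.mem_ker, hev, sub_eq_zero] at this

end Invariants

/-! ### The graph of `[[ρ], t] ↦ [t ρ]` is semi-algebraic -/

/-- A complex function whose real and imaginary parts are polynomials in given coordinates. -/
def IsPolynomialIn {Z ι : Type} (c : Z → ι → ℝ) (f : Z → ℂ) : Prop :=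
  ∃ p : Bool → MvPolynomial ι ℝ, ∀ z b, reIm (f z) b = MvPolynomial.eval (c z) (p b)

namespace IsPolynomialIn

variable {Z ι : Type} {c : Z → ι → ℝ} {f g : Z → ℂ}

theorem of_coord (e : Bool → ι) (h : ∀ z b, reIm (f z) b = c z (e b)) : IsPolynomialIn c f :=
  ⟨fun b => MvPolynomial.X (e b), fun z b => by simp [h]⟩

theorem zero : IsPolynomialIn c fun _ => 0 :=
  ⟨0, fun z b => by cases b <;> simp [reIm]⟩

theorem add (hf : IsPolynomialIn c f) (hg : IsPolynomialIn c g) :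
    IsPolynomialIn c fun z => f z + g z := by
  obtain ⟨p, hp⟩ := hf
  obtain ⟨q, hq⟩ := hg
  refine ⟨p + q, fun z b => ?_⟩
  rw [Pi.add_apply, map_add, ← hp, ← hq]
  cases b <;> simp [reIm]

theorem mul (hf : IsPolynomialIn c f) (hg : IsPolynomialIn c g) :
    IsPolynomialIn c fun z => f z * g z := by
  obtain ⟨p, hp⟩ := hf
  obtain ⟨q, hq⟩ := hg
  refine ⟨fun b => bif b then p false * q true + p true * q false
    else p false * q false - p true * q true, fun z b => ?_⟩
  cases b <;> simp [← hp, ← hq, reIm]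

theorem star (hf : IsPolynomialIn c f) : IsPolynomialIn c fun z => star (f z) := by
  obtain ⟨p, hp⟩ := hf
  refine ⟨fun b => bif b then - p true else p false, fun z b => ?_⟩
  cases b <;> simp [← hp, reIm]

theorem sum {α : Type} (s : Finset α) {f : α → Z → ℂ} (h : ∀ a, IsPolynomialIn c (f a)) :
    IsPolynomialIn c fun z => ∑ a ∈ s, f a z := by
  classical
  induction s using Finset.induction_on with
  | empty => simpa using zero
  | insert a s ha ih =>
    simp only [Finset.sum_insert ha]
    exact (h a).add ih

end IsPolynomialIn

/-- The real coordinates of a complex matrix. -/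
def matCoord {n : ℕ} (A : Matrix (Fin n) (Fin n) ℂ) (i : Fin n × Fin n × Bool) : ℝ :=
  reIm (A i.1 i.2.1) i.2.2

theorem continuous_reIm (b : Bool) : Continuous fun z => reIm z b := by
  cases b
  · exact Complex.continuous_re
  · exact Complex.continuous_im

/-- The real coordinates of a unitary representation. -/
def repCoordU {r n : ℕ} (ρ : RepVar r (Un n)) (i : Fin r × Fin n × Fin n × Bool) : ℝ :=
  matCoord (ρ.gen i.1).1 i.2

theorem continuous_repCoordU {r n : ℕ} :
    Continuous (repCoordU : RepVar r (Un n) → Fin r × Fin n × Fin n × Bool → ℝ) := by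
  refine continuous_pi fun i => (continuous_reIm _).comp ?_
  exact (continuous_subtype_val.comp (continuous_gen i.1)).matrix_elem i.2.1 i.2.2.1

/-- The inverse of a unitary matrix is its conjugate transpose, so conjugation is polynomial in the
real coordinates and the general criterion for compact groups applies. -/
theorem exists_finset_cls_eq_iff (r n : ℕ) :
    ∃ s : Finset (MvPolynomial ((Fin r × Fin n × Fin n × Bool) ⊕ (Fin r × Fin n × Fin n × Bool)) ℝ),
      ∀ ρ σ : RepVar r (Un n), cls ρ = cls σ ↔
        ∀ p ∈ s, MvPolynomial.eval (Sum.elim (repCoordU ρ) (repCoordU σ)) p = 0 := by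
  simp only [cls_eq_iff]
  refine exists_finset_mem_orbit_iff continuous_repCoordU
    (semialgU r n).coord_injective
    (cG := fun g : Un n => matCoord g.1) ?_ ?_
  · exact continuous_pi fun i => (continuous_reIm _).comp
      (continuous_subtype_val.matrix_elem i.1 i.2.1)
  · rintro ⟨k, i, j, b⟩
    let c : Un n × RepVar r (Un n) → (Fin n × Fin n × Bool) ⊕ (Fin r × Fin n × Fin n × Bool) → ℝ :=
      fun z => Sum.elim (matCoord z.1.1) (repCoordU z.2)
    have hg : ∀ a b, IsPolynomialIn c fun z => z.1.1 a b := fun a b =>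
      .of_coord (fun e => Sum.inl (a, b, e)) fun _ _ => rfl
    have hρ : ∀ a b, IsPolynomialIn c fun z => (z.2.gen k).1 a b := fun a b =>
      .of_coord (fun e => Sum.inr (k, a, b, e)) fun _ _ => rfl
    have h : IsPolynomialIn c fun z => ((z.1⁻¹ • z.2).gen k).1 i j := by
      have : (fun z : Un n × RepVar r (Un n) => ((z.1⁻¹ • z.2).gen k).1 i j) =
          fun z => ∑ b, (∑ a, star (z.1.1 a i) * (z.2.gen k).1 a b) * z.1.1 b j := by
        funext z
        rw [RepVar.gen_smul, inv_inv]
        change ((star z.1.1) * (z.2.gen k).1 * z.1.1) i j = _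
        simp only [Matrix.mul_apply, Matrix.star_apply]
      rw [this]
      exact .sum _ fun b => (IsPolynomialIn.sum _ fun a => ((hg a i).star).mul (hρ a b)).mul (hg b j)
    obtain ⟨p, hp⟩ := h
    exact ⟨p b, fun g x => hp (g, x) b⟩

theorem scaleU_gen_val {r n : ℕ} (t : Fin r → Circle) (ρ : RepVar r (SUn n)) (k : Fin r) :
    ((scaleU t ρ).gen k).1 = (t k : ℂ) • (ρ.gen k).1 := by
  rw [scaleU, RepVar.gen_ofTuple]
  change Matrix.scalar (Fin n) (t k : ℂ) * (ρ.gen k).1 = _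
  simp [Matrix.smul_eq_diagonal_mul]

/-- Upstairs, the graph consists of the triples `(ρ, t, σ)` with `t ρ` conjugate to `σ`. The
coordinates of `t ρ` are polynomial in those of `ρ` and `t`, so substitution in the orbit equations
describes the graph without projecting away a conjugating matrix. -/
theorem isSemialgMap_of_quotU {r n : ℕ} [NeZero n] (Φ : TwistedU r n → orbitSpace r (Un n))
    (hΦ : ∀ ρ t, Φ (quotU r n (cls ρ, t)) = cls (scaleU t ρ)) :
    SemialgQuotient.IsSemialgMap (semialgTwistedU r n) (semialgU r n) Φ := by
  obtain ⟨s, hs⟩ := exists_finset_cls_eq_iff r n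
  let Z : Type := (RepVar r (SUn n) × (Fin r → Circle)) × RepVar r (Un n)
  let ι : Type := ((Fin r × Fin n × Fin n × Bool) ⊕ (Fin r × Bool)) ⊕ (Fin r × Fin n × Fin n × Bool)
  let c : Z → ι → ℝ := ((semialgTwistedU r n).prod (semialgU r n)).coord
  have hc : ∀ i, ∃ p : MvPolynomial ι ℝ, ∀ z : Z,
      Sum.elim (repCoordU (scaleU z.1.2 z.1.1)) (repCoordU z.2) i =
        MvPolynomial.eval (c z) p := by
    rintro (⟨k, i, j, b⟩ | i)
    · have h : IsPolynomialIn c fun z => ((scaleU z.1.2 z.1.1).gen k).1 i j := by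
        have : (fun z : Z => ((scaleU z.1.2 z.1.1).gen k).1 i j) =
            fun z => (z.1.2 k : ℂ) * (z.1.1.gen k).1 i j := by
          funext z
          rw [scaleU_gen_val]
          rfl
        rw [this]
        exact .mul (.of_coord (fun e => Sum.inl (Sum.inr (k, e))) fun _ _ => rfl)
          (.of_coord (fun e => Sum.inl (Sum.inl (k, i, j, e))) fun _ _ => rfl)
      obtain ⟨p, hp⟩ := h
      exact ⟨p b, fun z => hp z b⟩
    · exact ⟨MvPolynomial.X (Sum.inr i), fun z => by
        rw [MvPolynomial.eval_X]
        rfl⟩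
  choose R hR using hc
  have key : ∀ z : Z, Φ (quotU r n (cls z.1.1, z.1.2)) = cls z.2 ↔
      ∀ p : s, MvPolynomial.eval (c z) (MvPolynomial.bind₁ R p.1) = 0 := fun z => by
    rw [hΦ, hs, Subtype.forall]
    refine forall₂_congr fun p _ => ?_
    rw [eval_bind₁, show Sum.elim (repCoordU (scaleU z.1.2 z.1.1)) (repCoordU z.2) =
      fun i => MvPolynomial.eval (c z) (R i) from funext fun i => hR i z]
  -- The equations cut out the graph only inside the coordinate image of the product, which is
  -- itself semi-algebraic.
  have hset : c '' {z : Z | Φ (quotU r n (cls z.1.1, z.1.2)) = cls z.2} = Set.range c ∩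
      ⋂ p : s, {x | MvPolynomial.eval x (MvPolynomial.bind₁ R p.1) = 0} := by
    ext x
    simp only [Set.mem_image, Set.mem_inter_iff, Set.mem_range, Set.mem_iInter]
    constructor
    · rintro ⟨z, hz, rfl⟩
      exact ⟨⟨z, rfl⟩, (key z).1 hz⟩
    · rintro ⟨⟨z, rfl⟩, hz⟩
      exact ⟨z, (key z).2 hz, rfl⟩
  change IsSemialgebraic (c '' {z : Z | Φ (quotU r n (cls z.1.1, z.1.2)) = cls z.2})
  rw [hset]
  exact ((semialgTwistedU r n).prod (semialgU r n)).range_coord.inter (.iInter fun p => .zero _)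

/-! ### The twisted product `X_r(SU(n)) ×_{Z_n^r} (S¹)^r` -/

section Unitary

variable {r n : ℕ}

theorem detU_coe (A : Un n) : (detU n A : ℂ) = A.1.det := rfl

theorem continuous_detU : Continuous (detU n) :=
  Continuous.subtype_mk continuous_subtype_val.matrix_det _

theorem continuous_circle_coe : Continuous fun c : Circle => (c : ℂ) := continuous_subtype_val

theorem detU_scaleU (t : Fin r → Circle) (ρ : RepVar r (SUn n)) (k : Fin r) :
    detU n ((scaleU t ρ).gen k) = t k ^ n := by
  apply Circle.ext
  rw [detU_coe, scaleU_gen_val, Matrix.det_smul,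
    (Matrix.mem_specialUnitaryGroup_iff.1 (ρ.gen k).2).2]
  simp

theorem scaleU_smul (t : Fin r → Circle) (g : SUn n) (ρ : RepVar r (SUn n)) :
    scaleU t (g • ρ) = inclSU n g • scaleU t ρ := by
  refine RepVar.ext_gen fun k => Subtype.ext ?_
  rw [scaleU_gen_val, RepVar.gen_smul, RepVar.gen_smul]
  change (t k : ℂ) • (g.1 * (ρ.gen k).1 * star g.1) =
    g.1 * ((scaleU t ρ).gen k).1 * star g.1
  rw [scaleU_gen_val]
  simp

theorem scaleU_injective (t : Fin r → Circle) :
    Function.Injective (scaleU t : RepVar r (SUn n) → RepVar r (Un n)) := by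
  intro ρ σ h
  refine RepVar.ext_gen fun k => Subtype.ext ?_
  have := congrArg (fun τ : RepVar r (Un n) => (τ.gen k).1) h
  simp only [scaleU_gen_val] at this
  exact smul_right_injective _ (Circle.coe_ne_zero (t k)) this

theorem continuous_scaleU :
    Continuous fun p : RepVar r (SUn n) × (Fin r → Circle) => scaleU p.2 p.1 := by
  rw [continuous_repVar_iff]
  intro k
  rw [Topology.IsInducing.subtypeVal.continuous_iff]
  refine Continuous.congr (f := fun p : RepVar r (SUn n) × (Fin r → Circle) =>
    (p.2 k : ℂ) • (p.1.gen k).1) ?_ fun p => (scaleU_gen_val p.2 p.1 k).symm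
  have h1 : Continuous fun p : RepVar r (SUn n) × (Fin r → Circle) => (p.2 k : ℂ) :=
    continuous_circle_coe.comp ((continuous_apply k).comp continuous_snd)
  have h2 : Continuous fun p : RepVar r (SUn n) × (Fin r → Circle) => (p.1.gen k).1 :=
    continuous_subtype_val.comp ((continuous_gen k).comp continuous_fst)
  exact h1.smul h2

/-- Division of a unitary matrix by an `n`-th root of its determinant. -/
def divU (c : Circle) (A : Un n) (h : c ^ n = detU n A) : SUn n :=
  ⟨((c⁻¹ : Circle) : ℂ) • A.1, by
    rw [Matrix.mem_specialUnitaryGroup_iff]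
    constructor
    · have : ((c⁻¹ : Circle) : ℂ) • A.1 = (scalarU n c⁻¹ * A).1 := by
        change _ = Matrix.scalar (Fin n) ((c⁻¹ : Circle) : ℂ) * A.1
        simp [Matrix.smul_eq_diagonal_mul]
      rw [this]
      exact (scalarU n c⁻¹ * A).2
    · rw [Matrix.det_smul, Fintype.card_fin, ← detU_coe, ← h, ← Circle.coe_pow, ← Circle.coe_mul]
      simp⟩

/-- Division of a unitary representation by `n`-th roots of the determinants of the generators. -/
def divRep (t : Fin r → Circle) (σ : RepVar r (Un n)) (h : ∀ k, t k ^ n = detU n (σ.gen k)) :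
    RepVar r (SUn n) :=
  RepVar.ofTuple fun k => divU (t k) (σ.gen k) (h k)

theorem divRep_gen_val (t : Fin r → Circle) (σ : RepVar r (Un n))
    (h : ∀ k, t k ^ n = detU n (σ.gen k)) (k : Fin r) :
    ((divRep t σ h).gen k).1 = (((t k)⁻¹ : Circle) : ℂ) • (σ.gen k).1 := by
  rw [divRep, RepVar.gen_ofTuple]
  rfl

theorem scaleU_divRep (t : Fin r → Circle) (σ : RepVar r (Un n))
    (h : ∀ k, t k ^ n = detU n (σ.gen k)) : scaleU t (divRep t σ h) = σ := by
  refine RepVar.ext_gen fun k => Subtype.ext ?_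
  rw [scaleU_gen_val, divRep_gen_val, smul_smul, ← Circle.coe_mul]
  simp

/-- The principal `n`-th root. -/
def circleRoot (n : ℕ) (z : Circle) : Circle := Circle.exp (Complex.arg z / n)

theorem circleRoot_pow [NeZero n] (z : Circle) : circleRoot n z ^ n = z := by
  have hn : (n : ℝ) ≠ 0 := Nat.cast_ne_zero.2 (NeZero.ne n)
  rw [circleRoot, ← Circle.exp_natCast_mul, mul_div_cancel₀ _ hn, Circle.exp_arg]

theorem continuousAt_circleRoot {z : Circle} (hz : (z : ℂ) ∈ Complex.slitPlane) :
    ContinuousAt (circleRoot n) z :=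
  Circle.exp.continuous.continuousAt.comp <|
    ((Complex.continuousAt_arg hz).comp continuous_circle_coe.continuousAt).div_const _

/-- Dividing `g` by an `n`-th root of its determinant changes it only by a scalar, which conjugates
trivially. -/
theorem exists_SU_smul_eq [NeZero n] (g : Un n) : ∃ h : SUn n, ∀ σ : RepVar r (Un n),
    g • σ = inclSU n h • σ := by
  let c := circleRoot n (detU n g)
  have hc : c ^ n = detU n g := circleRoot_pow _
  refine ⟨divU c g hc, fun σ => ?_⟩
  have hg : g = scalarU n c * inclSU n (divU c g hc) := by
    refine Subtype.ext ?_
    change g.1 = Matrix.scalar (Fin n) (c : ℂ) * (((c⁻¹ : Circle) : ℂ) • g.1)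
    rw [Matrix.scalar_apply, ← Matrix.smul_eq_diagonal_mul, smul_smul, ← Circle.coe_mul]
    simp
  nth_rewrite 1 [hg]
  rw [mul_smul]
  refine RepVar.ext_gen fun k => ?_
  rw [RepVar.gen_smul, mul_inv_eq_iff_eq_mul]
  refine Subtype.ext ?_
  exact (Matrix.scalar_commute (c : ℂ) (fun _ => Commute.all _ _) _).eq

/-- The map `([ρ], t) ↦ [t ρ]`. -/
def scaleClass (p : orbitSpace r (SUn n) × (Fin r → Circle)) : orbitSpace r (Un n) :=
  Quotient.lift (fun ρ => cls (scaleU p.2 ρ)) (by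
    rintro _ ρ ⟨g, rfl⟩
    change cls (scaleU p.2 (g • ρ)) = _
    rw [scaleU_smul, cls_smul]) p.1

theorem scaleClass_cls (ρ : RepVar r (SUn n)) (t : Fin r → Circle) :
    scaleClass (cls ρ, t) = cls (scaleU t ρ) := rfl

theorem isOpenQuotientMap_cls_prod : IsOpenQuotientMap
    (Prod.map cls id : RepVar r (SUn n) × (Fin r → Circle) → orbitSpace r (SUn n) × _) :=
  isOpenQuotientMap_cls.prodMap .id

theorem continuous_scaleClass :
    Continuous (scaleClass : orbitSpace r (SUn n) × (Fin r → Circle) → orbitSpace r (Un n)) := by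
  rw [isOpenQuotientMap_cls_prod.isQuotientMap.continuous_iff]
  exact isOpenQuotientMap_cls.continuous.comp continuous_scaleU

theorem continuous_detClassU : Continuous (detClassU r n) := by
  rw [isOpenQuotientMap_cls.isQuotientMap.continuous_iff]
  exact continuous_pi fun k => continuous_detU.comp (continuous_gen k)

theorem detClassU_scaleClass (p : orbitSpace r (SUn n) × (Fin r → Circle)) :
    detClassU r n (scaleClass p) = p.2 ^ n := by
  obtain ⟨x, t⟩ := p
  obtain ⟨ρ, rfl⟩ := cls_surjective x
  exact funext fun k => detU_scaleU t ρ k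

variable [NeZero n]

theorem scaleU_surjective :
    Function.Surjective fun p : RepVar r (SUn n) × (Fin r → Circle) => scaleU p.2 p.1 := fun σ =>
  ⟨(divRep (fun k => circleRoot n (detU n (σ.gen k))) σ fun _ => circleRoot_pow _, _),
    scaleU_divRep _ _ _⟩

theorem twistSU_gen_val (ζ : Fin r → Zn n) (ρ : RepVar r (SUn n)) (k : Fin r) :
    ((twistSU ζ ρ).gen k).1 = ((ζ k : ℂˣ) : ℂ) • (ρ.gen k).1 := by
  rw [twistSU, RepVar.gen_ofTuple]
  change Matrix.scalar (Fin n) ((ζ k : ℂˣ) : ℂ) * (ρ.gen k).1 = _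
  simp [Matrix.smul_eq_diagonal_mul]

theorem scaleU_twistSU (ζ : Fin r → Zn n) (t : Fin r → Circle) (ρ : RepVar r (SUn n)) :
    scaleU (fun k => (rootsOfUnitytoCircle n (ζ k))⁻¹ * t k) (twistSU ζ ρ) = scaleU t ρ := by
  refine RepVar.ext_gen fun k => Subtype.ext ?_
  rw [scaleU_gen_val, scaleU_gen_val, twistSU_gen_val, smul_smul]
  congr 1
  have : (rootsOfUnitytoCircle n (ζ k) : ℂ) = ((ζ k : ℂˣ) : ℂ) := rfl
  rw [← this, ← Circle.coe_mul]
  congr 1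
  rw [mul_right_comm, inv_mul_cancel, one_mul]

/-- Comparing determinants gives `s^n = t^n`, so `ζ = s / t` consists of roots of unity; cancelling
the scaling by `t` identifies `σ`. -/
theorem exists_twist_of_scaleU_eq {s t : Fin r → Circle} {ρ σ : RepVar r (SUn n)}
    (h : scaleU s ρ = scaleU t σ) :
    ∃ ζ : Fin r → Zn n, σ = twistSU ζ ρ ∧
      t = fun k => (rootsOfUnitytoCircle n (ζ k))⁻¹ * s k := by
  have hpow : ∀ k, (s k / t k) ^ n = 1 := fun k => by
    rw [div_pow, ← detU_scaleU s ρ k, ← detU_scaleU t σ k, h, div_self']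
  have hpow' : ∀ k, ((s k / t k : Circle) : ℂ) ^ n = 1 := fun k => by
    rw [← Circle.coe_pow, hpow, Circle.coe_one]
  let ζ : Fin r → Zn n := fun k => rootsOfUnity.mkOfPowEq _ (hpow' k)
  have hζ : ∀ k, rootsOfUnitytoCircle n (ζ k) = s k / t k := fun k => Circle.ext rfl
  have ht : t = fun k => (rootsOfUnitytoCircle n (ζ k))⁻¹ * s k := by
    funext k
    rw [hζ]
    simp
  refine ⟨ζ, scaleU_injective t ?_, ht⟩
  rw [← h]
  conv_rhs => rw [ht]
  rw [scaleU_twistSU]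

/-- The map `[[ρ], t] ↦ [t ρ]`. -/
def twistedToU : TwistedU r n → orbitSpace r (Un n) :=
  Quotient.lift scaleClass (by
    rintro _ ⟨x, t⟩ ⟨ζ, rfl⟩
    obtain ⟨ρ, rfl⟩ := cls_surjective x
    change cls (scaleU (fun k => (rootsOfUnitytoCircle n (ζ k))⁻¹ * t k) (twistSU ζ ρ)) =
      cls (scaleU t ρ)
    rw [scaleU_twistSU])

theorem twistedToU_injective : Function.Injective (twistedToU (r := r) (n := n)) := by
  intro x y h
  obtain ⟨⟨x, s⟩, rfl⟩ := quotU_surjective r n x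
  obtain ⟨⟨y, t⟩, rfl⟩ := quotU_surjective r n y
  obtain ⟨ρ, rfl⟩ := cls_surjective x
  obtain ⟨σ, rfl⟩ := cls_surjective y
  change cls (scaleU s ρ) = cls (scaleU t σ) at h
  obtain ⟨g, hg⟩ := cls_eq_iff.1 h
  obtain ⟨g', hg'⟩ := exists_SU_smul_eq (r := r) g
  -- The conjugating matrix can be taken in `SU(n)` and absorbed into `σ`, leaving an equality of
  -- representations.
  have h1 : scaleU s ρ = scaleU t (g' • σ) := by
    rw [scaleU_smul, ← hg', ← hg]
  obtain ⟨ζ, h2, h3⟩ := exists_twist_of_scaleU_eq h1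
  let _ := prodAction (r := r) (n := n)
  refine (Quotient.sound (s := MulAction.orbitRel (Fin r → Zn n) _) ?_).symm
  refine ⟨ζ, Prod.ext ?_ h3.symm⟩
  change cls (twistSU ζ ρ) = cls σ
  rw [← h2, cls_smul]

/-- Before passing to classes, scaling is a continuous surjection from a compact space to a
Hausdorff one, hence a quotient map. Its composite with the class map factors through the twisted
product, and the last factor inherits the quotient property. -/
theorem isQuotientMap_twistedToU : Topology.IsQuotientMap (twistedToU (r := r) (n := n)) := by
  have hs : Topology.IsQuotientMap
      fun p : RepVar r (SUn n) × (Fin r → Circle) => scaleU p.2 p.1 :=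
    continuous_scaleU.isClosedMap.isQuotientMap continuous_scaleU scaleU_surjective
  have hq : Continuous (quotU r n) := continuous_coinduced_rng
  refine .of_comp (hq.comp isOpenQuotientMap_cls_prod.continuous) ?_
    (isOpenQuotientMap_cls.isQuotientMap.comp hs)
  exact continuous_coinduced_dom.2 continuous_scaleClass

/-- The homeomorphism `[[ρ], t] ↦ [t ρ]`. -/
def twistedHomeo (r n : ℕ) [NeZero n] : TwistedU r n ≃ₜ orbitSpace r (Un n) :=
  (Equiv.ofBijective twistedToU ⟨twistedToU_injective, isQuotientMap_twistedToU.surjective⟩).toHomeomorph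
    fun _ => isQuotientMap_twistedToU.isOpen_preimage

theorem twistedHomeo_quotU (ρ : RepVar r (SUn n)) (t : Fin r → Circle) :
    twistedHomeo r n (quotU r n (cls ρ, t)) = cls (scaleU t ρ) := rfl

/-! ### Local triviality of the determinant -/

section Trivialization

variable (s : (Fin r → Circle) → (Fin r → Circle)) (hs : ∀ t, s t ^ n = t)

/-- Division of the class of a unitary representation by the values of a section `s` of the `n`-th
power map at the determinants. -/
def divClass : orbitSpace r (Un n) → orbitSpace r (SUn n) :=
  Quotient.lift (fun σ => cls (divRep (s fun k => detU n (σ.gen k)) σ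
    fun k => congrFun (hs _) k)) (by
    rintro _ σ ⟨g, rfl⟩
    obtain ⟨h, hh⟩ := exists_SU_smul_eq (r := r) g
    rw [← cls_smul h (divRep _ σ _)]
    dsimp only
    congr 1
    have hdet : (fun k => detU n ((g • σ).gen k)) = fun k => detU n (σ.gen k) := by
      funext k
      simp
    refine scaleU_injective (s fun k => detU n ((g • σ).gen k)) ?_
    rw [scaleU_divRep, scaleU_smul]
    simp only [hdet]
    rw [scaleU_divRep, hh])

theorem divClass_cls (σ : RepVar r (Un n)) : divClass s hs (cls σ) =
    cls (divRep (s fun k => detU n (σ.gen k)) σ fun k => congrFun (hs _) k) := rfl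

theorem scaleClass_divClass (x : orbitSpace r (Un n)) :
    scaleClass (divClass s hs x, s (detClassU r n x)) = x := by
  obtain ⟨σ, rfl⟩ := cls_surjective x
  exact congrArg cls (scaleU_divRep _ σ _)

theorem divClass_scaleClass (x : orbitSpace r (SUn n)) (t : Fin r → Circle) :
    divClass s hs (scaleClass (x, s t)) = x := by
  obtain ⟨ρ, rfl⟩ := cls_surjective x
  rw [scaleClass_cls, divClass_cls]
  congr 1
  have hdet : (fun k => detU n ((scaleU (s t) ρ).gen k)) = t := by
    refine Eq.trans ?_ (hs t)
    exact funext fun k => detU_scaleU _ ρ k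
  simp only [hdet]
  exact scaleU_injective (s t) (scaleU_divRep _ _ _)

theorem continuousAt_divClass {x : orbitSpace r (Un n)}
    (hx : ContinuousAt s (detClassU r n x)) : ContinuousAt (divClass s hs) x := by
  obtain ⟨σ, rfl⟩ := cls_surjective x
  -- Continuity at a class may be tested on representatives because the class map is an open
  -- quotient map.
  rw [← isOpenQuotientMap_cls.continuousAt_comp_iff]
  refine isOpenQuotientMap_cls.continuous.continuousAt.comp ?_
  rw [continuousAt_repVar_iff]
  intro k
  rw [Topology.IsInducing.subtypeVal.continuousAt_iff]
  refine ContinuousAt.congr (f := fun σ : RepVar r (Un n) =>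
    (((s (detClassU r n (cls σ)) k)⁻¹ : Circle) : ℂ) • (σ.gen k).1) ?_ (.of_forall fun σ => (divRep_gen_val
    (s fun k => detU n (σ.gen k)) σ (fun k => congrFun (hs _) k) k).symm)
  have h1 : ContinuousAt (fun σ : RepVar r (Un n) => s (detClassU r n (cls σ))) σ :=
    ContinuousAt.comp (f := fun σ : RepVar r (Un n) => detClassU r n (cls σ)) hx
      (continuous_detClassU.comp isOpenQuotientMap_cls.continuous).continuousAt
  have h2 : ContinuousAt (fun σ : RepVar r (Un n) => s (detClassU r n (cls σ)) k) σ :=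
    (continuous_apply k).continuousAt.comp h1
  have h3 : Continuous fun σ : RepVar r (Un n) => (σ.gen k).1 :=
    continuous_subtype_val.comp (continuous_gen k)
  exact (continuous_circle_coe.continuousAt.comp h2.inv).smul h3.continuousAt

/-- A section of the `n`-th power map, continuous on an open set, trivializes the determinant. -/
def detTrivialization (B : Set (Fin r → Circle)) (hB : IsOpen B)
    (hcont : ∀ t ∈ B, ContinuousAt s t) :
    Bundle.Trivialization (orbitSpace r (SUn n)) (detClassU r n) where
  toFun x := (detClassU r n x, divClass s hs x)
  invFun p := scaleClass (p.2, s p.1)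
  source := detClassU r n ⁻¹' B
  target := B ×ˢ Set.univ
  map_source' x hx := ⟨hx, trivial⟩
  map_target' p hp := by
    rw [Set.mem_preimage, detClassU_scaleClass, hs]
    exact hp.1
  left_inv' x _ := scaleClass_divClass s hs x
  right_inv' p _ := by
    refine Prod.ext ?_ (divClass_scaleClass s hs p.2 p.1)
    exact (detClassU_scaleClass _).trans (hs _)
  open_source := hB.preimage continuous_detClassU
  open_target := hB.prod isOpen_univ
  continuousOn_toFun x hx := (continuous_detClassU.continuousAt.prodMk
    (continuousAt_divClass s hs (hcont _ hx))).continuousWithinAt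
  continuousOn_invFun p hp := by
    refine ContinuousAt.continuousWithinAt ?_
    refine continuous_scaleClass.continuousAt.comp (continuousAt_snd.prodMk ?_)
    exact ContinuousAt.comp (f := Prod.fst) (hcont _ hp.1) continuousAt_fst
  baseSet := B
  open_baseSet := hB
  source_eq := rfl
  target_eq := rfl
  proj_toFun _ _ := rfl

end Trivialization

theorem exists_trivialization (t : Fin r → Circle) :
    ∃ e : Bundle.Trivialization (orbitSpace r (SUn n)) (detClassU r n), t ∈ e.baseSet := by
  -- The principal root is translated so that its cut avoids `t`: the section is defined everywhere
  -- and continuous wherever each `u k / t k` lies off the closed negative real axis, in particular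
  -- at `u = t`.
  let s : (Fin r → Circle) → (Fin r → Circle) := fun u k =>
    circleRoot n (t k) * circleRoot n (u k / t k)
  have hs : ∀ u, s u ^ n = u := fun u => by
    funext k
    simp only [s, Pi.pow_apply, mul_pow, circleRoot_pow, mul_div_cancel]
  let f : Fin r → (Fin r → Circle) → Circle := fun k u => u k / t k
  have hf : ∀ k, Continuous (f k) := fun k => (continuous_apply k).div' continuous_const
  let B : Set (Fin r → Circle) := ⋂ k, {u | (f k u : ℂ) ∈ Complex.slitPlane}
  have hB : IsOpen B := isOpen_iInter_of_finite fun k =>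
    Complex.isOpen_slitPlane.preimage (continuous_circle_coe.comp (hf k))
  refine ⟨detTrivialization s hs B hB fun u hu => ?_, ?_⟩
  · refine continuousAt_pi.2 fun k => continuousAt_const.mul ?_
    exact ContinuousAt.comp (f := f k) (continuousAt_circleRoot (Set.mem_iInter.1 hu k))
      (hf k).continuousAt
  · refine Set.mem_iInter.2 fun k => ?_
    simp [f, Complex.one_mem_slitPlane]

end Unitary

end CharVar

end

theorem mainTheorem6 (r n : ℕ) [NeZero n] :
    -- `Z_n`, the group of `n`-th roots of unity, is the centre of `SL_n` and of `SU(n)`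
    (Subgroup.center (SLn n) = (scalarSL n).range ∧
      Subgroup.center (SUn n) = (scalarSU n).range) ∧
    -- `X_r(GL_n) ≅ X_r(SL_n) ×_{Z_n^r} (ℂ*)^r` over `Spec ℂ`, as a twisted bundle over `(ℂ*)^r`
    (∃ Φ : twistedGL r n ≅ charVariety r (stdGL n),
      (∀ (ρ : RepVar r (SLn n)) (t : Fin r → ℂˣ),
        ptProd ρ t ≫ quotGL r n ≫ Φ.hom = ptGL (scaleGL t ρ)) ∧
      CategoryTheory.IsPullback (quotGL r n ≫ Φ.hom) (projTorus r n)
        (detGL r n) (powTorus r n)) ∧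
    -- `X_r(U(n)) ≅ X_r(SU(n)) ×_{Z_n^r} (S¹)^r` as semi-algebraic sets, as a twisted bundle
    -- over `(S¹)^r`
    (∃ Φ : TwistedU r n ≃ₜ orbitSpace r (Un n),
      SemialgQuotient.IsSemialgMap (semialgTwistedU r n) (semialgU r n) Φ ∧
      (∀ (ρ : RepVar r (SUn n)) (t : Fin r → Circle),
        Φ (quotU r n (cls ρ, t)) = cls (scaleU t ρ) ∧
        detClassU r n (Φ (quotU r n (cls ρ, t))) = t ^ n) ∧
      ∀ t : Fin r → Circle,
        ∃ e : Bundle.Trivialization (orbitSpace r (SUn n)) (detClassU r n), t ∈ e.baseSet) := by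
  refine ⟨⟨center_SL n, center_SU n⟩,
    ⟨affineIso (twistedEquiv r n), ptProd_comp, isPullback_detGL⟩,
    twistedHomeo r n, isSemialgMap_of_quotU _ twistedHomeo_quotU, fun ρ t => ⟨rfl, ?_⟩,
    exists_trivialization⟩
  exact detClassU_scaleClass (cls ρ, t)
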